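/- Let $\mathbb F_q$ be a finite field, $\mathcal N=\{1,\dots,N\}$, and let $h:2^{\mathcal N}\to\mathbb R$ satisfy $h(\emptyset)=0$. **Linear group characterizable functions.** $\Gamma^*_{L(q)}$ is the set of functions $\alpha\mapsto H(U_i: i\in\alpha)$ on $2^{\mathcal N}$, where $G$ is a finite vector space over $\mathbb F_q$ with subspaces $G_1,\dots,G_N$, $U$ is uniform on $G$, and $U_i$ is the coset of $G_i$ containing $U$. $\overline{\mathrm{con}}(\Gamma^*_{L(q)})$ is the minimal closed convex cone containing $\Gamma^*_{L(q)}$. $h$ is *almost linear group characterizable* if $h=\lim_k h^{(k)}/r(k)$ for some $h^{(k)}\in\Gamma^*_{L(q)}$ and $r(k)>0$. **Network codes.** For a finite directed acyclic graph with edge set $\mathcal E$ and independent sessions $s\in\mathcal S$, each with an origin node and a set of receiver nodes, a network code consists of finite nonempty alphabets $\mathcal U_f$ ($f\in\mathcal S\cup\mathcal E$) and, for each edge $e$, a coding function computing the symbol $U_e\in\mathcal U_e$ from the symbols of the sources located at, and the edges entering, the tail of $e$. The source symbols $U_s$ are independent and uniform on $\mathcal U_s$. $P_e$ is the probability, under optimal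 decoding, that some receiver fails to reconstruct a message it requires from the symbols available at it. The code is linear over $\mathbb F_q$ if all alphabets are $\mathbb F_q$-vector spaces and all coding functions are $\mathbb F_q$-linear. A tuple $(\lambda,\omega)\in\mathbb R^{\mathcal S}\times\mathbb R^{\mathcal E}$ is *achievable by linear codes over $\mathbb F_q$* if there are such codes $\Phi^{(n)}$ and constants $r(n)>0$ with $$\lim_n \tfrac{H(U^{(n)}_e)}{r(n)}\le\lim_n\tfrac{\log|\mathcal U^{(n)}_e|}{r(n)}\le\omega_e\ (e\in\mathcal E),\qquad \lim_n \tfrac{H(U^{(n)}_s)}{r(n)}=\lim_n\tfrac{\log|\mathcal U^{(n)}_s|}{r(n)}\ge\lambda_s\ (s\in\mathcal S)$$ (all limits existing), and $P_e(\Phi^{(n)})\to0$; it is *asymptotically admissible by linear codes over $\mathbb F_q$* if this is possible with $P_e(\Phi^{(n)})=0$ for all $n$. **The network $G^\dagger$ and the tuple $T(h)=(\lambda(h),\omega(h))$.** There is one session $S_{[\alpha]}$ for each $\emptyset\ne\alpha\subseteq\mathcal N$, with its own source node and rate $h(\alpha)$. Edges without a stated capacity are uncapacitated; they are given the capacity $\sum_{\alpha}h(\alpha)$.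 * For each $j\in\mathcal N$, an edge $V_j$ of capacity $h(j)$ goes from the source $S_{[\mathcal N]}$ to a node that sends copies of $V_j$ to the subnetworks below. * Type 0, for each $\emptyset\ne\alpha\subseteq\mathcal N$: an edge of capacity $h(\alpha)$ from the source $S_{[\alpha]}$ to a receiver requiring $S_{[\alpha]}$. * Type 1, for each $\emptyset\ne\alpha\subseteq\mathcal N$: a receiver requiring $S_{[\mathcal N]}$, with an edge of capacity $h(\mathcal N)-h(\alpha)$ from the source $S_{[\mathcal N]}$ and an edge of capacity $h(\alpha)$ from an intermediate node that is fed by copies of $V_j$, $j\in\alpha$. * Type 2, for each $\emptyset\ne\alpha\subset\mathcal N$ and $i\in\mathcal N\setminus\alpha$: a node fed by copies of $V_j$, $j\in\alpha$, emits an edge $W^{**}$ of capacity $h(\alpha)$, which is duplicated to nodes $c$ and $d$. Node $c$ is also fed by the source $S_{[\alpha]}$ and emits an edge $W$ of capacity $h(\alpha)$, which is duplicated to an upper and a lower receiver. The upper receiver is also fed by the source $S_{[\alpha]}$ and by an edge $W'$ of capacity $h(\mathcal N)-h(\alpha)$ from the source $S_{[\mathcal N]}$, and requires $S_{[\mathcal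 N]}$. Node $d$ is also fed by a copy of $V_i$ and emits an edge $W''$ of capacity $h(\alpha\cup\{i\})-h(i)$ to a node $d'$, which is also fed by a copy of $V_i$ and emits an edge $W^*$ of capacity $h(\alpha)$ to the lower receiver. The lower receiver requires $S_{[\alpha]}$. **Theorem.** The following are equivalent: 1. $h\in\overline{\mathrm{con}}(\Gamma^*_{L(q)})$; 2. $h$ is almost linear group characterizable; 3. $T(h)$ is asymptotically admissible on $G^\dagger$ by linear codes over $\mathbb F_q$; 4. $T(h)$ is achievable on $G^\dagger$ by linear codes over $\mathbb F_q$. -/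

import Mathlib

open Filter Topology

namespace NetCode

universe u

/-! ### Entropy of finite random variables -/

/-- The uniform distribution on a finite nonempty set. -/
noncomputable def uniformLaw (A : Type u) [Finite A] [Nonempty A] : PMF A :=
  letI := Fintype.ofFinite A
  PMF.uniformOfFintype A

/-- Shannon entropy (in nats) of a distribution on a finite set. -/
noncomputable def entropy {A : Type u} [Finite A] (p : PMF A) : ℝ :=
  ∑ᶠ a, Real.negMulLog (p a).toReal

/-! ### Linear group characterizable functions -/

instance finiteQuotient {F G : Type u} [Field F] [AddCommGroup G] [Module F G] [Finite G]
    (W : Submodule F G) : Finite (G ⧸ W) :=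
  Finite.of_surjective W.mkQ W.mkQ_surjective

/-- The joint law of the random variables `U_i`, `i ∈ α`, where `U_i` is the coset of `W i` that
contains a uniformly distributed element of the finite vector space `G`. -/
noncomputable def cosetLaw {F G : Type u} [Field F] [AddCommGroup G] [Module F G] [Finite G]
    {N : ℕ} (W : Fin N → Submodule F G) (α : Finset (Fin N)) : PMF (∀ i : α, G ⧸ W i) :=
  (uniformLaw G).map fun g i => (W i).mkQ g

/-- The set of functions on the subsets of `{1, …, N}` that are the entropy function of random
variables constructed from a finite vector space over `F` and `N` subspaces of it. -/
def linearGroupChar (F : Type u) [Field F] (N : ℕ) : Set (Finset (Fin N) → ℝ) :=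
  {h | ∃ (G : Type u) (_ : AddCommGroup G) (_ : Module F G) (_ : Finite G)
      (W : Fin N → Submodule F G), ∀ α, h α = entropy (cosetLaw W α)}

/-- `h` is a limit of positively rescaled linear group characterizable functions. -/
def AlmostLinearGroupChar (F : Type u) [Field F] {N : ℕ} (h : Finset (Fin N) → ℝ) : Prop :=
  ∃ (g : ℕ → Finset (Fin N) → ℝ) (r : ℕ → ℝ), (∀ k, g k ∈ linearGroupChar F N) ∧
    (∀ k, 0 < r k) ∧ ∀ α, Tendsto (fun k => g k α / r k) atTop (𝓝 (h α))

/-- The minimal closed convex cone containing a set of functions. -/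
noncomputable def closedConvexCone {N : ℕ} (S : Set (Finset (Fin N) → ℝ)) :
    ConvexCone ℝ (Finset (Fin N) → ℝ) :=
  (ConvexCone.hull ℝ S).closure

/-! ### Networks and network codes -/

/-- A directed acyclic (multi)graph with node set `P` and edge set `E`. -/
structure Network (P E : Type) where
  tail : E → P
  head : E → P
  acyclic : ∀ v, ¬ Relation.TransGen (fun a b => ∃ e, tail e = a ∧ head e = b) v v

/-- A connection requirement with sessions `S`. -/
structure Requirement (P S : Type) where
  origin : S → P
  dest : S → Set P

variable {P E S : Type}

/-- The sources and edges that are incident to the node `v`. -/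
def arrives (G : Network P E) (M : Requirement P S) (v : P) : S ⊕ E → Prop
  | .inl s => M.origin s = v
  | .inr e => G.head e = v

/-- The index set of the messages available at the node `v`. -/
abbrev Incoming (G : Network P E) (M : Requirement P S) (v : P) : Type :=
  {f : S ⊕ E // arrives G M v f}

/-- A network code: finite alphabets and local coding functions. -/
structure Code (G : Network P E) (M : Requirement P S) where
  alphabet : S ⊕ E → Type u
  finite : ∀ f, Finite (alphabet f)
  nonempty : ∀ f, Nonempty (alphabet f)
  enc : ∀ e : E, (∀ f : Incoming G M (G.tail e), alphabet f.1) → alphabet (.inr e)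

attribute [instance] Code.finite Code.nonempty

theorem Network.wellFounded [Finite E] (G : Network P E) :
    WellFounded fun f e : E => G.head f = G.tail e := by
  let R : E → E → Prop := Relation.TransGen fun f e : E => G.head f = G.tail e
  have hirr : Std.Irrefl R := ⟨fun e he => G.acyclic (G.tail e)
    (Relation.TransGen.lift (p := fun a b => ∃ e, G.tail e = a ∧ G.head e = b) G.tail
      (fun f _ hfe => ⟨f, rfl, hfe⟩) _ _ he)⟩
  have htr : IsTrans E R := ⟨fun _ _ _ => Relation.TransGen.trans⟩
  have hwf : WellFounded R := Finite.wellFounded_of_trans_of_irrefl R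
  exact Subrelation.wf (r := R) (fun {_ _} h => Relation.TransGen.single h) hwf

namespace Code

variable {G : Network P E} {M : Requirement P S}

/-- The tuples of source symbols. -/
abbrev Input (Φ : Code.{u} G M) : Type u := ∀ s : S, Φ.alphabet (.inl s)

/-- The symbol on each link, as a function of the source symbols. -/
noncomputable def link [Finite E] (Φ : Code.{u} G M) (x : Φ.Input) :
    ∀ e : E, Φ.alphabet (.inr e) :=
  G.wellFounded.fix fun e ih => Φ.enc e fun
    | ⟨.inl s, _⟩ => x s
    | ⟨.inr f, hf⟩ => ih f hf

/-- The symbol of each source and link, as a function of the source symbols. -/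
noncomputable def symbol [Finite E] (Φ : Code.{u} G M) (x : Φ.Input) :
    ∀ f : S ⊕ E, Φ.alphabet f
  | .inl s => x s
  | .inr e => Φ.link x e

theorem symbol_inr [Finite E] (Φ : Code.{u} G M) (x : Φ.Input) (e : E) :
    Φ.symbol x (.inr e) = Φ.enc e fun f => Φ.symbol x f.1 := by
  change Φ.link x e = _
  unfold link
  rw [WellFounded.fix_eq]
  congr 1
  funext f
  rcases f with ⟨s | f, hf⟩ <;> rfl

/-- The law of the source or link random variable `U_f`; the sources are independent and
uniformly distributed. -/
noncomputable def law [Finite S] [Finite E] (Φ : Code.{u} G M) (f : S ⊕ E) :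
    PMF (Φ.alphabet f) :=
  (uniformLaw Φ.Input).map fun x => Φ.symbol x f

/-- The logarithm of the size of an alphabet. -/
noncomputable def logCard (Φ : Code.{u} G M) (f : S ⊕ E) : ℝ :=
  Real.log (Nat.card (Φ.alphabet f))

/-- For each session and each of its receivers, a decoding function. -/
def Decoder (Φ : Code.{u} G M) : Type u :=
  ∀ (s : S) (v : M.dest s), (∀ f : Incoming G M v.1, Φ.alphabet f.1) → Φ.alphabet (.inl s)

/-- The probability that some receiver fails to reconstruct one of its requested messages. -/
noncomputable def errorProbWith [Finite S] [Finite E] (Φ : Code.{u} G M) (δ : Φ.Decoder) : ℝ :=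
  ((uniformLaw Φ.Input).toOuterMeasure
    {x | ∃ (s : S) (v : M.dest s), δ s v (fun f => Φ.symbol x f.1) ≠ x s}).toReal

/-- The error probability of a code, with optimal decoding. -/
noncomputable def errorProb [Finite S] [Finite E] (Φ : Code.{u} G M) : ℝ :=
  ⨅ δ : Φ.Decoder, Φ.errorProbWith δ

/-- All alphabets are vector spaces over `F` and all local coding functions are linear. -/
def IsLinear (F : Type u) [Field F] (Φ : Code.{u} G M) : Prop :=
  ∃ (_ : ∀ f, AddCommGroup (Φ.alphabet f)) (_ : ∀ f, Module F (Φ.alphabet f)),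
    ∀ e, IsLinearMap F (Φ.enc e)

end Code

/-! ### Rate-capacity tuples -/

section Rates

variable [Finite S] [Finite E] {G : Network P E} {M : Requirement P S}

/-- The normalized link entropies and alphabet sizes converge to at most the capacities `ω`, and
the normalized source entropies converge to at least the rates `lam`. -/
def MeetsRates (Φ : ℕ → Code.{u} G M) (r : ℕ → ℝ) (lam : S → ℝ) (ω : E → ℝ) : Prop :=
  (∀ e : E, ∃ a b : ℝ,
    Tendsto (fun n => entropy ((Φ n).law (.inr e)) / r n) atTop (𝓝 a) ∧
    Tendsto (fun n => (Φ n).logCard (.inr e) / r n) atTop (𝓝 b) ∧ a ≤ b ∧ b ≤ ω e) ∧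
  (∀ s : S, ∃ a : ℝ,
    Tendsto (fun n => entropy ((Φ n).law (.inl s)) / r n) atTop (𝓝 a) ∧
    Tendsto (fun n => (Φ n).logCard (.inl s) / r n) atTop (𝓝 a) ∧ lam s ≤ a)

/-- `(lam, ω)` is asymptotically admissible by network codes in the class `C`. -/
def AsymptoticallyAdmissible (C : Code.{u} G M → Prop) (lam : S → ℝ) (ω : E → ℝ) : Prop :=
  ∃ (Φ : ℕ → Code.{u} G M) (r : ℕ → ℝ), (∀ n, C (Φ n)) ∧ (∀ n, 0 < r n) ∧
    MeetsRates Φ r lam ω ∧ ∀ n, (Φ n).errorProb = 0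

/-- `(lam, ω)` is achievable by network codes in the class `C`. -/
def Achievable (C : Code.{u} G M → Prop) (lam : S → ℝ) (ω : E → ℝ) : Prop :=
  ∃ (Φ : ℕ → Code.{u} G M) (r : ℕ → ℝ), (∀ n, C (Φ n)) ∧ (∀ n, 0 < r n) ∧
    MeetsRates Φ r lam ω ∧ Tendsto (fun n => (Φ n).errorProb) atTop (𝓝 0)

end Rates

/-! ### The network constructed from `N` -/

/-- The nonempty subsets of `{1, …, N}`; they index the sessions. -/
abbrev NESet (N : ℕ) : Type := {α : Finset (Fin N) // α.Nonempty}

/-- The full set, which is nonempty as soon as there is an element. -/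
def NESet.full {N : ℕ} (j : Fin N) : NESet N := ⟨Finset.univ, ⟨j, Finset.mem_univ j⟩⟩

/-- The full set, which is nonempty as soon as there is a nonempty subset. -/
def NESet.top {N : ℕ} (α : NESet N) : NESet N :=
  ⟨Finset.univ, α.2.mono (Finset.subset_univ _)⟩

/-- Pairs of a nonempty set `α` and an element `i ∉ α`; they index the type 2 subnetworks. -/
abbrev Pair (N : ℕ) : Type := {t : NESet N × Fin N // t.2 ∉ t.1.1}

/-- The nonempty set of a pair `(α, i)`. -/
abbrev Pair.set {N : ℕ} (t : Pair N) : NESet N := t.1.1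

/-- The element of a pair `(α, i)`. -/
abbrev Pair.elt {N : ℕ} (t : Pair N) : Fin N := t.1.2

/-- The nodes. -/
inductive Node (N : ℕ) : Type
  /-- the origin of session `α` -/
  | source (α : NESet N)
  /-- the node that duplicates the message `V_j` -/
  | dup (j : Fin N)
  /-- type 0: the receiver -/
  | sink0 (α : NESet N)
  /-- type 1: the node that collects `V_j`, `j ∈ α` -/
  | mid1 (α : NESet N)
  /-- type 1: the receiver -/
  | sink1 (α : NESet N)
  /-- type 2: the node that collects `V_j`, `j ∈ α` -/
  | collect (t : Pair N)
  /-- type 2: the node that duplicates `W**` -/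
  | fork (t : Pair N)
  /-- type 2: the node that combines `W**` with the source `α` -/
  | combine (t : Pair N)
  /-- type 2: the node that duplicates `W` -/
  | split (t : Pair N)
  /-- type 2: the node that sees `W**` and `V_i` -/
  | compress (t : Pair N)
  /-- type 2: the node that sees `W''` and `V_i` -/
  | expand (t : Pair N)
  /-- type 2: the receiver that requires the source `{1, …, N}` -/
  | upper (t : Pair N)
  /-- type 2: the receiver that requires the source `α` -/
  | lower (t : Pair N)

set_option synthInstance.maxHeartbeats 400000 in
set_option synthInstance.maxSize 4096 in
/-- The edges. Constructors whose name starts with `fwd` are the uncapacitated edges. -/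
inductive Edge (N : ℕ) : Type
  /-- the edge carrying `V_j` -/
  | V (j : Fin N)
  /-- type 0: `W` -/
  | W0 (α : NESet N)
  /-- type 1: `W` -/
  | W1 (α : NESet N)
  /-- type 1: `W'` -/
  | W1' (α : NESet N)
  /-- type 1: a copy of `V_j`, `j ∈ α` -/
  | fwdV1 (α : NESet N) (j : α.1)
  /-- type 2: `W` -/
  | W2 (t : Pair N)
  /-- type 2: `W'` -/
  | W2' (t : Pair N)
  /-- type 2: `W''` -/
  | W2'' (t : Pair N)
  /-- type 2: `W*` -/
  | Wstar (t : Pair N)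
  /-- type 2: `W**` -/
  | Wstarstar (t : Pair N)
  /-- type 2: a copy of `V_j`, `j ∈ α` -/
  | fwdV2 (t : Pair N) (j : t.set.1)
  /-- type 2: the first copy of `V_i` -/
  | fwdViCompress (t : Pair N)
  /-- type 2: the second copy of `V_i` -/
  | fwdViExpand (t : Pair N)
  /-- type 2: the source `α`, to the combining node -/
  | fwdSCombine (t : Pair N)
  /-- type 2: the source `α`, to the upper receiver -/
  | fwdSUpper (t : Pair N)
  /-- type 2: a copy of `W**`, to the combining node -/
  | fwdForkCombine (t : Pair N)
  /-- type 2: a copy of `W**`, to the compressing node -/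
  | fwdForkCompress (t : Pair N)
  /-- type 2: a copy of `W`, to the upper receiver -/
  | fwdWUpper (t : Pair N)
  /-- type 2: a copy of `W`, to the lower receiver -/
  | fwdWLower (t : Pair N)
  deriving Fintype

/-- The tail of an edge. -/
def Edge.tail {N : ℕ} : Edge N → Node N
  | .V j => .source (.full j)
  | .W0 α => .source α
  | .W1 α => .source α.top
  | .W1' α => .mid1 α
  | .fwdV1 _ j => .dup j.1
  | .W2 t => .combine t
  | .W2' t => .source t.set.top
  | .W2'' t => .compress t
  | .Wstar t => .expand t
  | .Wstarstar t => .collect t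
  | .fwdV2 _ j => .dup j.1
  | .fwdViCompress t => .dup t.elt
  | .fwdViExpand t => .dup t.elt
  | .fwdSCombine t => .source t.set
  | .fwdSUpper t => .source t.set
  | .fwdForkCombine t => .fork t
  | .fwdForkCompress t => .fork t
  | .fwdWUpper t => .split t
  | .fwdWLower t => .split t

/-- The head of an edge. -/
def Edge.head {N : ℕ} : Edge N → Node N
  | .V j => .dup j
  | .W0 α => .sink0 α
  | .W1 α => .sink1 α
  | .W1' α => .sink1 α
  | .fwdV1 α _ => .mid1 α
  | .W2 t => .split t
  | .W2' t => .upper t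
  | .W2'' t => .expand t
  | .Wstar t => .lower t
  | .Wstarstar t => .fork t
  | .fwdV2 t _ => .collect t
  | .fwdViCompress t => .compress t
  | .fwdViExpand t => .expand t
  | .fwdSCombine t => .combine t
  | .fwdSUpper t => .upper t
  | .fwdForkCombine t => .combine t
  | .fwdForkCompress t => .compress t
  | .fwdWUpper t => .upper t
  | .fwdWLower t => .lower t

/-- A topological ordering of the nodes. -/
def Node.depth {N : ℕ} : Node N → ℕ
  | .source _ => 0
  | .dup _ => 1
  | .sink0 _ => 1
  | .mid1 _ => 2
  | .sink1 _ => 3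
  | .collect _ => 2
  | .fork _ => 3
  | .combine _ => 4
  | .split _ => 5
  | .compress _ => 4
  | .expand _ => 5
  | .upper _ => 6
  | .lower _ => 6

theorem Edge.depth_lt {N : ℕ} (e : Edge N) : e.tail.depth < e.head.depth := by
  cases e <;> simp [Edge.tail, Edge.head, Node.depth]

/-- The network `G†`. -/
def dualNetwork (N : ℕ) : Network (Node N) (Edge N) where
  tail := Edge.tail
  head := Edge.head
  acyclic v hv := by
    have key : ∀ a b : Node N,
        Relation.TransGen (fun a b => ∃ e : Edge N, e.tail = a ∧ e.head = b) a b →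
        a.depth < b.depth := by
      intro a b hab
      induction hab with
      | single h => obtain ⟨e, rfl, rfl⟩ := h; exact e.depth_lt
      | tail _ h ih => obtain ⟨e, rfl, rfl⟩ := h; exact ih.trans e.depth_lt
    exact lt_irrefl _ (key v v hv)

/-- The session required by a node, if the node is a receiver. -/
def Node.demand {N : ℕ} : Node N → Option (NESet N)
  | .sink0 α => some α
  | .sink1 α => some α.top
  | .upper t => some t.set.top
  | .lower t => some t.set
  | _ => none

/-- The connection requirement `M†`. -/
def dualRequirement (N : ℕ) : Requirement (Node N) (NESet N) where
  origin := Node.source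
  dest α := {v | v.demand = some α}

/-- The source rates of the tuple `T(h)`. -/
def rate {N : ℕ} (h : Finset (Fin N) → ℝ) (α : NESet N) : ℝ := h α.1

/-- The link capacities of the tuple `T(h)`. The remaining edges are the uncapacitated ones. Their
capacity is the sum of all the values of `h`. -/
def capacity {N : ℕ} (h : Finset (Fin N) → ℝ) : Edge N → ℝ
  | .V j => h {j}
  | .W0 α => h α.1
  | .W1 α => h Finset.univ - h α.1
  | .W1' α => h α.1
  | .W2 t => h t.set.1
  | .W2' t => h Finset.univ - h t.set.1
  | .W2'' t => h (insert t.elt t.set.1) - h {t.elt}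
  | .Wstar t => h t.set.1
  | .Wstarstar t => h t.set.1
  | _ => ∑ α, h α

end NetCode

/-! A linear image of a uniform vector is uniform on the range, so its entropy is the log-index of
the kernel (`entropy_uniformLaw_map`). Joint variables correspond to intersections of kernels, and
Shannon-type inequalities become the dimension formula.

Cone versus limits: direct products make the linear group characterizable functions closed under
addition, and real coefficients are approximated by integer multiples divided by a large integer.
Hence the limits of positive multiples already form a closed convex cone
(`mem_closedConvexCone_iff`).

Subspaces to codes: write U_α for the coset of a vector modulo the intersection of the `W i`, i ∈ α.
The full session carries the coset U_N, and `V_j` carries U_j. In type 2, W** and W* carry U_α, W''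
carries what U_i lacks of U_{α∪i}, and W is the sum of the source α and U_α. The upper receiver
subtracts the source and the lower receiver subtracts U_α. This is a zero-error code with the right
rates (`exists_code_of_linearGroupChar`).

Codes to subspaces: a linear code with error below 1/2 has no errors (`eq_zero_of_errorProb_lt`).
The kernels of the `V_j` give a linear group characterizable function g. Type 1 bounds g from below.
Type 2 bounds g(α∪i) above in terms of g(α) (`logIndex_inf_le_of_subnetwork`). After normalization,
an induction on α squeezes g to h. -/

namespace NetCode

universe u

/-! ### Entropy of linear images of a uniform random variable -/

section LogIndex

variable {F : Type u} [Field F] {A : Type u} [AddCommGroup A] [Module F A] [Finite A]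

/-- The logarithm of the index of a subspace. -/
noncomputable def logIndex (K : Submodule F A) : ℝ := Real.log (Nat.card (A ⧸ K))

theorem logIndex_eq_finrank_mul [Finite F] (K : Submodule F A) :
    logIndex K = Module.finrank F (A ⧸ K) * Real.log (Nat.card F) := by
  rw [logIndex, Module.natCard_eq_pow_finrank (K := F) (V := A ⧸ K)]
  push_cast
  rw [Real.log_pow]

theorem logIndex_anti {K L : Submodule F A} (h : K ≤ L) : logIndex L ≤ logIndex K :=
  Real.log_le_log (by exact_mod_cast Nat.card_pos)
    (by exact_mod_cast Nat.card_le_card_of_surjective _ (Submodule.factor_surjective h))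

omit [Finite A] in
theorem logIndex_top : logIndex (⊤ : Submodule F A) = 0 := by
  have : Subsingleton (A ⧸ (⊤ : Submodule F A)) := Submodule.Quotient.subsingleton_iff.2 rfl
  simp [logIndex]

theorem logIndex_nonneg (K : Submodule F A) : 0 ≤ logIndex K := by
  rw [← logIndex_top (F := F) (A := A)]
  exact logIndex_anti le_top

theorem logIndex_inf_add_logIndex_sup [Finite F] (K L : Submodule F A) :
    logIndex (K ⊓ L) + logIndex (K ⊔ L) = logIndex K + logIndex L := by
  simp only [logIndex_eq_finrank_mul, ← add_mul]
  congr 1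
  have h := Submodule.finrank_sup_add_finrank_inf_eq K L
  have h1 := Submodule.finrank_quotient_add_finrank K
  have h2 := Submodule.finrank_quotient_add_finrank L
  have h3 := Submodule.finrank_quotient_add_finrank (K ⊓ L)
  have h4 := Submodule.finrank_quotient_add_finrank (K ⊔ L)
  norm_cast
  omega

/-- Submodularity of entropy: `M` is the kernel of a common function of the two variables with
kernels `K` and `L`. -/
theorem logIndex_inf_add_le [Finite F] {K L M : Submodule F A} (hK : K ≤ M) (hL : L ≤ M) :
    logIndex (K ⊓ L) + logIndex M ≤ logIndex K + logIndex L := by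
  rw [← logIndex_inf_add_logIndex_sup K L]
  exact add_le_add_right (logIndex_anti (sup_le hK hL)) _

theorem logIndex_inf_le [Finite F] (K L : Submodule F A) :
    logIndex (K ⊓ L) ≤ logIndex K + logIndex L := by
  have := logIndex_inf_add_le (K := K) (L := L) le_top le_top
  rwa [logIndex_top, add_zero] at this

theorem logIndex_inf_of_sup_eq_top [Finite F] {K L : Submodule F A} (h : K ⊔ L = ⊤) :
    logIndex (K ⊓ L) = logIndex K + logIndex L := by
  rw [← logIndex_inf_add_logIndex_sup, h, logIndex_top, add_zero]

variable {B : Type*} [AddCommGroup B] [Module F B]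

omit [Finite A] in
theorem logIndex_ker_of_surjective {f : A →ₗ[F] B} (hf : Function.Surjective f) :
    logIndex (LinearMap.ker f) = Real.log (Nat.card B) := by
  rw [logIndex, Nat.card_congr (f.quotKerEquivOfSurjective hf).toEquiv]

theorem logIndex_ker_le [Finite B] (f : A →ₗ[F] B) :
    logIndex (LinearMap.ker f) ≤ Real.log (Nat.card B) := by
  refine Real.log_le_log (by exact_mod_cast Nat.card_pos) ?_
  rw [Nat.card_congr f.quotKerEquivRange.toEquiv]
  exact_mod_cast Nat.card_le_card_of_injective _ (Subtype.val_injective (p := (· ∈ f.range)))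

/-- The fibre of `f` through `a` is a translate of the kernel. -/
theorem uniformLaw_map_apply [Finite B] (f : A →ₗ[F] B) (a : A) :
    (((uniformLaw A).map f) (f a)).toReal = (Nat.card (A ⧸ LinearMap.ker f) : ℝ)⁻¹ := by
  classical
  let := Fintype.ofFinite A
  have hcard : (Finset.univ.filter fun x => f a = f x).card = Nat.card (LinearMap.ker f) := by
    rw [← Fintype.card_subtype, ← Nat.card_eq_fintype_card]
    refine Nat.card_congr
      ⟨fun x => ⟨x.1 - a, by simp [x.2]⟩, fun x => ⟨x.1 + a, ?_⟩, fun x => ?_, fun x => ?_⟩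
    · simp [LinearMap.mem_ker.1 x.2]
    · simp
    · simp
  rw [PMF.map_apply, tsum_fintype, ← Finset.sum_filter]
  simp only [uniformLaw, PMF.uniformOfFintype_apply, Finset.sum_const, nsmul_eq_mul, hcard]
  have hA := (LinearMap.ker f).card_eq_card_quotient_mul_card
  have hK : (Nat.card (LinearMap.ker f) : ℝ) ≠ 0 := by exact_mod_cast Nat.card_pos.ne'
  have hQ : (Nat.card (A ⧸ LinearMap.ker f) : ℝ) ≠ 0 := by exact_mod_cast Nat.card_pos.ne'
  rw [← Nat.card_eq_fintype_card, hA]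
  simp only [ENNReal.toReal_mul, ENNReal.toReal_natCast, ENNReal.toReal_inv, Nat.cast_mul]
  field_simp

theorem entropy_uniformLaw_map [Finite B] (f : A →ₗ[F] B) :
    entropy ((uniformLaw A).map f) = logIndex (LinearMap.ker f) := by
  classical
  let := Fintype.ofFinite B
  have hsupp : ∀ b, b ∉ Set.range f → ((uniformLaw A).map f) b = 0 := by
    intro b hb
    rw [PMF.map_apply, ENNReal.tsum_eq_zero]
    intro a
    rw [if_neg]
    rintro rfl
    exact hb ⟨a, rfl⟩
  have hcard : (Finset.univ.filter fun b => b ∈ Set.range f).card =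
      Nat.card (A ⧸ LinearMap.ker f) := by
    rw [← Fintype.card_subtype, ← Nat.card_eq_fintype_card]
    exact Nat.card_congr f.quotKerEquivRange.symm.toEquiv
  have hQ : (Nat.card (A ⧸ LinearMap.ker f) : ℝ) ≠ 0 := by exact_mod_cast Nat.card_pos.ne'
  rw [entropy, finsum_eq_sum_of_fintype, logIndex,
    ← Finset.sum_filter_of_ne (p := fun b => b ∈ Set.range f)]
  · rw [Finset.sum_congr rfl (g := fun _ =>
      Real.negMulLog (Nat.card (A ⧸ LinearMap.ker f) : ℝ)⁻¹)]
    · rw [Finset.sum_const, hcard, nsmul_eq_mul, Real.negMulLog, Real.log_inv]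
      field_simp
    · intro b hb
      obtain ⟨a, rfl⟩ := (Finset.mem_filter.1 hb).2
      rw [uniformLaw_map_apply]
  -- Points outside the range have probability 0 and contribute `negMulLog 0 = 0`.
  · intro b _ hb
    by_contra h
    exact hb (by rw [hsupp b h]; simp)

end LogIndex

/-! ### Linear group characterizable functions -/

section LinearGroupChar

variable {F : Type u} [Field F] {N : ℕ}

theorem entropy_cosetLaw {G : Type u} [AddCommGroup G] [Module F G] [Finite G]
    (W : Fin N → Submodule F G) (α : Finset (Fin N)) :
    entropy (cosetLaw W α) = logIndex (⨅ i ∈ α, W i) := by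
  have h := entropy_uniformLaw_map (LinearMap.pi fun i : α => (W i).mkQ)
  rw [LinearMap.ker_pi] at h
  simp only [Submodule.ker_mkQ] at h
  rw [iInf_subtype (p := fun i => i ∈ α) (f := fun i => W i)] at h
  exact h

theorem mem_linearGroupChar_iff {h : Finset (Fin N) → ℝ} :
    h ∈ linearGroupChar F N ↔ ∃ (G : Type u) (_ : AddCommGroup G) (_ : Module F G) (_ : Finite G)
      (W : Fin N → Submodule F G), ∀ α, h α = logIndex (⨅ i ∈ α, W i) := by
  simp only [linearGroupChar, Set.mem_ofPred_eq, entropy_cosetLaw]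

theorem logIndex_mem_linearGroupChar {G : Type u} [AddCommGroup G] [Module F G] [Finite G]
    (W : Fin N → Submodule F G) :
    (fun α => logIndex (⨅ i ∈ α, W i)) ∈ linearGroupChar F N :=
  mem_linearGroupChar_iff.2 ⟨G, _, _, inferInstance, W, fun _ => rfl⟩

theorem logIndex_prod {G G' : Type u} [AddCommGroup G] [Module F G] [Finite G]
    [AddCommGroup G'] [Module F G'] [Finite G'] (K : Submodule F G) (L : Submodule F G') :
    logIndex (K.prod L) = logIndex K + logIndex L := by
  have h := logIndex_ker_of_surjective (f := K.mkQ.prodMap L.mkQ)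
    (Function.Surjective.prodMap K.mkQ_surjective L.mkQ_surjective)
  rw [LinearMap.ker_prodMap, Submodule.ker_mkQ, Submodule.ker_mkQ, Nat.card_prod, Nat.cast_mul,
    Real.log_mul (by exact_mod_cast Nat.card_pos.ne') (by exact_mod_cast Nat.card_pos.ne')] at h
  exact h

variable (F N) in
/-- The linear group characterizable functions are closed under addition. -/
def linearGroupCharAddSubmonoid : AddSubmonoid (Finset (Fin N) → ℝ) where
  carrier := linearGroupChar F N
  zero_mem' := mem_linearGroupChar_iff.2 ⟨PUnit, inferInstance, inferInstance, inferInstance,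
    fun _ => ⊤, fun α => by simp [logIndex_top]⟩
  add_mem' := by
    intro g g' hg hg'
    obtain ⟨G, _, _, _, W, hW⟩ := mem_linearGroupChar_iff.1 hg
    obtain ⟨G', _, _, _, W', hW'⟩ := mem_linearGroupChar_iff.1 hg'
    refine mem_linearGroupChar_iff.2 ⟨G × G', inferInstance, inferInstance, inferInstance,
      fun i => (W i).prod (W' i), fun α => ?_⟩
    have : ⨅ i ∈ α, (W i).prod (W' i) = (⨅ i ∈ α, W i).prod (⨅ i ∈ α, W' i) := by
      ext x
      simp only [Submodule.mem_iInf, Submodule.mem_prod]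
      exact ⟨fun h => ⟨fun i hi => (h i hi).1, fun i hi => (h i hi).2⟩,
        fun h i hi => ⟨h.1 i hi, h.2 i hi⟩⟩
    rw [this, logIndex_prod, Pi.add_apply, hW, hW']

theorem nsmul_mem_linearGroupChar {g : Finset (Fin N) → ℝ} (hg : g ∈ linearGroupChar F N)
    (n : ℕ) : n • g ∈ linearGroupChar F N :=
  (linearGroupCharAddSubmonoid F N).nsmul_mem hg n

theorem add_mem_linearGroupChar {g g' : Finset (Fin N) → ℝ} (hg : g ∈ linearGroupChar F N)
    (hg' : g' ∈ linearGroupChar F N) : g + g' ∈ linearGroupChar F N :=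
  (linearGroupCharAddSubmonoid F N).add_mem hg hg'

/-! ### The closed convex cone -/

variable (F N) in
/-- The positive multiples of linear group characterizable functions. -/
def scaledLinearGroupChar : Set (Finset (Fin N) → ℝ) :=
  {x | ∃ g ∈ linearGroupChar F N, ∃ c : ℝ, 0 < c ∧ x = c • g}

theorem almostLinearGroupChar_iff_mem_closure {h : Finset (Fin N) → ℝ} :
    AlmostLinearGroupChar F h ↔ h ∈ closure (scaledLinearGroupChar F N) := by
  rw [mem_closure_iff_seq_limit]
  constructor
  · rintro ⟨g, r, hg, hr, hlim⟩
    refine ⟨fun k => (r k)⁻¹ • g k, fun k => ⟨g k, hg k, _, inv_pos.2 (hr k), rfl⟩, ?_⟩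
    rw [tendsto_pi_nhds]
    intro α
    simpa [div_eq_inv_mul] using hlim α
  · rintro ⟨x, hx, hlim⟩
    choose g hg c hc hxc using hx
    refine ⟨g, fun k => (c k)⁻¹, hg, fun k => inv_pos.2 (hc k), fun α => ?_⟩
    have := (tendsto_pi_nhds.1 hlim) α
    simpa [hxc, mul_comm] using this

/-- Replace c by ⌊c·m⌋ / m with m → ∞: integer combinations stay linear group characterizable, and m
becomes the normalization. -/
theorem smul_add_smul_mem_closure {g g' : Finset (Fin N) → ℝ} (hg : g ∈ linearGroupChar F N)
    (hg' : g' ∈ linearGroupChar F N) {c c' : ℝ} (hc : 0 < c) (hc' : 0 < c') :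
    c • g + c' • g' ∈ closure (scaledLinearGroupChar F N) := by
  rw [← almostLinearGroupChar_iff_mem_closure]
  refine ⟨fun n => ⌊c * (n + 1 : ℕ)⌋₊ • g + ⌊c' * (n + 1 : ℕ)⌋₊ • g', fun n => (n + 1 : ℕ),
    fun n => add_mem_linearGroupChar (nsmul_mem_linearGroupChar hg _)
      (nsmul_mem_linearGroupChar hg' _), fun n => by positivity, fun α => ?_⟩
  have key : ∀ {c : ℝ}, 0 < c → Tendsto
      (fun n : ℕ => (⌊c * (n + 1 : ℕ)⌋₊ : ℝ) / ((n + 1 : ℕ) : ℝ)) atTop (𝓝 c) := fun {c} hc =>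
    (tendsto_nat_floor_mul_div_atTop hc.le).comp
      (tendsto_natCast_atTop_atTop.comp (tendsto_add_atTop_nat 1))
  have := ((key hc).mul_const (g α)).add ((key hc').mul_const (g' α))
  refine (this.congr fun n => ?_)
  beta_reduce
  rw [Pi.add_apply, Pi.smul_apply, Pi.smul_apply, nsmul_eq_mul, nsmul_eq_mul]
  ring

variable (F N) in
/-- The limits of positive multiples of linear group characterizable functions. -/
def almostLinearGroupCharCone : ConvexCone ℝ (Finset (Fin N) → ℝ) where
  carrier := closure (scaledLinearGroupChar F N)
  smul_mem' := by
    intro c hc x hx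
    refine map_mem_closure (continuous_const_smul c) hx ?_
    rintro _ ⟨g, hg, d, hd, rfl⟩
    exact ⟨g, hg, c * d, mul_pos hc hd, smul_smul _ _ _⟩
  add_mem' := by
    intro x hx y hy
    -- A sum of two scaled functions is only known to lie in the closure, so the closure is taken
    -- twice and then collapsed.
    have h := map_mem_closure₂ (u := closure (scaledLinearGroupChar F N))
      (f := fun x y : Finset (Fin N) → ℝ => x + y) continuous_add hx hy ?_
    · rwa [closure_closure] at h
    rintro _ ⟨g, hg, c, hc, rfl⟩ _ ⟨g', hg', c', hc', rfl⟩
    exact smul_add_smul_mem_closure hg hg' hc hc'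

theorem mem_closedConvexCone_iff {h : Finset (Fin N) → ℝ} :
    h ∈ closedConvexCone (linearGroupChar F N) ↔ AlmostLinearGroupChar F h := by
  rw [almostLinearGroupChar_iff_mem_closure, closedConvexCone, ConvexCone.mem_closure]
  constructor
  · intro hh
    have hle : ConvexCone.hull ℝ (linearGroupChar F N) ≤ almostLinearGroupCharCone F N :=
      ConvexCone.hull_min fun g hg => subset_closure ⟨g, hg, 1, one_pos, (one_smul _ _).symm⟩
    have := closure_mono (show (ConvexCone.hull ℝ (linearGroupChar F N) : Set _) ⊆
      closure (scaledLinearGroupChar F N) from hle) hh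
    rwa [closure_closure] at this
  · refine fun hh => closure_mono ?_ hh
    rintro _ ⟨g, hg, c, hc, rfl⟩
    exact (ConvexCone.hull ℝ _).smul_mem hc (ConvexCone.subset_hull hg)

end LinearGroupChar


/-! ### Linear network codes -/

namespace Code

variable {P E S : Type} {G : Network P E} {M : Requirement P S} [Finite E]
  {F : Type u} [Field F] (Φ : Code.{u} G M)
  [∀ f, AddCommGroup (Φ.alphabet f)] [∀ f, Module F (Φ.alphabet f)]

/-- Induction along the acyclic order of the edges, composing linear maps. -/
theorem symbol_isLinearMap (hΦ : ∀ e, IsLinearMap F (Φ.enc e)) (f : S ⊕ E) :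
    IsLinearMap F fun x : Φ.Input => Φ.symbol x f := by
  rcases f with s | e
  · exact ⟨fun _ _ => rfl, fun _ _ => rfl⟩
  induction e using G.wellFounded.induction with
  | _ e ih =>
    have hf : ∀ f : Incoming G M (G.tail e), IsLinearMap F fun x : Φ.Input => Φ.symbol x f.1 := by
      rintro ⟨s | f, hf⟩
      · exact ⟨fun _ _ => rfl, fun _ _ => rfl⟩
      · exact ih f hf
    constructor
    · intro x y
      simp only [symbol_inr]
      rw [← (hΦ e).map_add]
      exact congrArg (Φ.enc e) (funext fun f => (hf f).map_add x y)
    · intro c x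
      simp only [symbol_inr]
      rw [← (hΦ e).map_smul]
      exact congrArg (Φ.enc e) (funext fun f => (hf f).map_smul c x)

/-- The symbol of a source or link of a linear code, as a linear function of the source symbols. -/
noncomputable def symbolMap (hΦ : ∀ e, IsLinearMap F (Φ.enc e)) (f : S ⊕ E) :
    Φ.Input →ₗ[F] Φ.alphabet f :=
  (Φ.symbol_isLinearMap hΦ f).mk' _

/-- The source symbols for which a source or link of a linear code is silent. -/
noncomputable def kernel (hΦ : ∀ e, IsLinearMap F (Φ.enc e)) (f : S ⊕ E) : Submodule F Φ.Input :=
  LinearMap.ker (Φ.symbolMap hΦ f)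

variable {Φ} (hΦ : ∀ e, IsLinearMap F (Φ.enc e))

theorem mem_kernel {x : Φ.Input} {f : S ⊕ E} :
    x ∈ Φ.kernel hΦ f ↔ Φ.symbol x f = 0 := Iff.rfl

/-- A linear coding function sends 0 to 0. This is how the topology of the network turns into
inclusions of kernels. -/
theorem mem_kernel_of_arrives {x : Φ.Input} {e : E}
    (h : ∀ f, arrives G M (G.tail e) f → x ∈ Φ.kernel hΦ f) :
    x ∈ Φ.kernel hΦ (.inr e) := by
  rw [mem_kernel, symbol_inr, ← (hΦ e).map_zero]
  exact congrArg (Φ.enc e) (funext fun f => h f.1 f.2)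

variable [Finite S]

theorem logIndex_kernel_le (f : S ⊕ E) :
    logIndex (Φ.kernel hΦ f) ≤ Φ.logCard f :=
  logIndex_ker_le _

omit [Finite S] in
theorem symbolMap_inl_surjective (s : S) : Function.Surjective (Φ.symbolMap hΦ (.inl s)) := by
  classical
  intro a
  exact ⟨Pi.single (M := fun s => Φ.alphabet (.inl s)) s a,
    Pi.single_eq_same (M := fun s => Φ.alphabet (.inl s)) s a⟩

omit [Finite S] in
theorem logIndex_kernel_inl (s : S) :
    logIndex (Φ.kernel hΦ (.inl s)) = Φ.logCard (.inl s) :=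
  logIndex_ker_of_surjective (symbolMap_inl_surjective hΦ s)

omit [Finite S] in
-- Independence of two distinct sources, in the form that makes log-indices additive: any input
-- splits off its `s`-coordinate.
theorem kernel_inl_sup {s t : S} (hst : s ≠ t) :
    Φ.kernel hΦ (.inl s) ⊔ Φ.kernel hΦ (.inl t) = ⊤ := by
  classical
  rw [eq_top_iff]
  intro x _
  have hx : x = (x - Pi.single (M := fun s => Φ.alphabet (.inl s)) s (x s)) +
      Pi.single (M := fun s => Φ.alphabet (.inl s)) s (x s) := (sub_add_cancel _ _).symm
  rw [hx]
  refine Submodule.add_mem_sup ?_ ?_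
  · change x s - Pi.single (M := fun s => Φ.alphabet (.inl s)) s (x s) s = 0
    rw [Pi.single_eq_same, sub_self]
  · exact Pi.single_eq_of_ne hst.symm _

omit [Field F] [∀ f, AddCommGroup (Φ.alphabet f)] [∀ f, Module F (Φ.alphabet f)] in
theorem errorProbWith_nonneg (δ : Φ.Decoder) : 0 ≤ Φ.errorProbWith δ := ENNReal.toReal_nonneg

omit [Field F] [∀ f, AddCommGroup (Φ.alphabet f)] [∀ f, Module F (Φ.alphabet f)] in
theorem errorProbWith_eq (δ : Φ.Decoder) : Φ.errorProbWith δ =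
    (Nat.card {x : Φ.Input |
      ∃ (s : S) (v : M.dest s), δ s v (fun f => Φ.symbol x f.1) ≠ x s} : ℝ) /
    Nat.card Φ.Input := by
  classical
  let := Fintype.ofFinite Φ.Input
  rw [errorProbWith, uniformLaw, PMF.toOuterMeasure_uniformOfFintype_apply]
  simp only [ENNReal.toReal_div, ENNReal.toReal_natCast, Nat.card_eq_fintype_card]

/-- A linear code with small error probability has no errors: two inputs that differ by a nonzero
undetectable vector cannot both be decoded. -/
theorem eq_zero_of_errorProb_lt (herr : Φ.errorProb < 1 / 2) {s : S} {v : P} (hv : v ∈ M.dest s)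
    {x : Φ.Input} (hx : ∀ f, arrives G M v f → x ∈ Φ.kernel hΦ f) :
    x ∈ Φ.kernel hΦ (.inl s) := by
  classical
  by_contra hne
  have : Nonempty Φ.Decoder := ⟨fun _ _ _ => Classical.arbitrary _⟩
  obtain ⟨δ, hδ⟩ := exists_lt_of_ciInf_lt herr
  rw [errorProbWith_eq] at hδ
  set bad : Set Φ.Input := {x | ∃ (s : S) (v : M.dest s),
    δ s v (fun f => Φ.symbol x f.1) ≠ x s} with hbad
  -- The inputs `y` and `y + x` look the same at the receiver `v` but differ in the source `s`, so
  -- at most one of them is decoded correctly.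
  have hcover : ∀ y : Φ.Input, y ∈ bad ∨ y + x ∈ bad := by
    intro y
    by_contra! hy
    simp only [hbad, Set.mem_ofPred_eq, not_exists, not_not] at hy
    have h1 := hy.1 s ⟨v, hv⟩
    have h2 := hy.2 s ⟨v, hv⟩
    have h3 : (fun f : Incoming G M v => Φ.symbol (y + x) f.1) =
        fun f : Incoming G M v => Φ.symbol y f.1 := by
      funext f
      have := (Φ.symbol_isLinearMap hΦ f.1).map_add y x
      rw [this, (mem_kernel hΦ).1 (hx f.1 f.2), add_zero]
    rw [h3, h1] at h2
    exact hne (by simpa using h2 : x s = 0)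
  -- Thus `bad` and its translate by `-x` cover all inputs, so the error probability is at least
  -- 1/2.
  have hle : Nat.card Φ.Input ≤ Nat.card (bad ⊕ bad) := by
    refine Nat.card_le_card_of_surjective
      (Sum.elim (fun y => y.1) fun y => y.1 - x : bad ⊕ bad → Φ.Input) fun y => ?_
    rcases hcover y with hy | hy
    · exact ⟨.inl ⟨y, hy⟩, rfl⟩
    · exact ⟨.inr ⟨_, hy⟩, by simp⟩
  rw [Nat.card_sum] at hle
  have hpos : (0 : ℝ) < Nat.card Φ.Input := by exact_mod_cast Nat.card_pos
  rw [div_lt_div_iff₀ hpos two_pos] at hδ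
  have : (Nat.card Φ.Input : ℝ) ≤ Nat.card bad + Nat.card bad := by exact_mod_cast hle
  linarith

end Code

/-! ### Linear codes for the dual network -/

/-- The rank inequality that is enforced by a type 2 subnetwork. -/
theorem logIndex_inf_le_of_subnetwork {F : Type u} [Field F] [Finite F]
    {I : Type u} [AddCommGroup I] [Module F I] [Finite I]
    {A B P Q R W W' W'' T : Submodule F I} (hAB : A ⊔ B = ⊤) (hAP : A ≤ P) (hAQ : A ≤ Q)
    (hPR : P ≤ R) (hW : R ⊓ B ≤ W) (hW'' : R ⊓ Q ≤ W'') (hT : W'' ⊓ Q ≤ T)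
    (hA : W ⊓ B ⊓ W' ≤ A) (hB : W ⊓ T ≤ B) :
    logIndex (P ⊓ Q) ≤ logIndex Q + logIndex W'' + logIndex P + logIndex W + logIndex W' -
      logIndex B - logIndex A := by
  have hAT : A ≤ T ⊓ R :=
    le_inf ((le_inf ((le_inf (hAP.trans hPR) hAQ).trans hW'') hAQ).trans hT) (hAP.trans hPR)
  -- First half, in entropies of the variables with these kernels: H(P,Q) ≤ H(Q) + H(W'') + H(P) −
  -- I(T;R). Here `R` is a function of `P`, and `T` is a function of `Q` and `W''`.
  have a1 : logIndex (P ⊓ Q) ≤ logIndex (Q ⊓ W'' ⊓ R ⊓ P) :=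
    logIndex_anti (le_inf inf_le_right (inf_le_left.trans (inf_le_left.trans inf_le_left)))
  have a2 : logIndex (Q ⊓ W'' ⊓ R ⊓ P) + logIndex R ≤ logIndex (Q ⊓ W'' ⊓ R) + logIndex P :=
    logIndex_inf_add_le inf_le_right hPR
  have b1 : logIndex (Q ⊓ W'' ⊓ R) ≤ logIndex (Q ⊓ W'' ⊓ (T ⊓ R)) :=
    logIndex_anti (inf_le_inf_left _ inf_le_right)
  have b2 : logIndex (Q ⊓ W'' ⊓ (T ⊓ R)) + logIndex T ≤
      logIndex (Q ⊓ W'') + logIndex (T ⊓ R) :=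
    logIndex_inf_add_le (by rwa [inf_comm]) inf_le_left
  have b3 := logIndex_inf_le Q W''
  -- Second half: I(T;R) ≥ H(B,W) − H(W) ≥ H(A) + H(B) − H(W) − H(W'). It uses that `T` and `R` are
  -- functions of `A`, which is independent of `B`, and that the two receivers decode.
  have c1 : logIndex (T ⊓ R ⊓ B) = logIndex (T ⊓ R) + logIndex B :=
    logIndex_inf_of_sup_eq_top (eq_top_iff.2 (hAB ▸ sup_le_sup_right hAT B))
  have c2 : logIndex (T ⊓ R ⊓ B) ≤ logIndex (B ⊓ W ⊓ T ⊓ (R ⊓ B)) :=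
    logIndex_anti (le_inf (le_inf (inf_le_left.trans inf_le_right) (inf_le_right.trans inf_le_left))
      (inf_le_right.trans inf_le_right))
  have c3 : logIndex (B ⊓ W ⊓ T ⊓ (R ⊓ B)) + logIndex (B ⊓ W) ≤
      logIndex (B ⊓ W ⊓ T) + logIndex (R ⊓ B) :=
    logIndex_inf_add_le inf_le_left (le_inf inf_le_right hW)
  have c4 : logIndex (B ⊓ W ⊓ T) ≤ logIndex (W ⊓ T) :=
    logIndex_anti (le_inf (le_inf hB inf_le_left) inf_le_right)
  have c5 := logIndex_inf_le W T
  have c6 := logIndex_inf_le R B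
  have c7 : logIndex (A ⊓ B) = logIndex A + logIndex B := logIndex_inf_of_sup_eq_top hAB
  have c8 : logIndex (A ⊓ B) ≤ logIndex (B ⊓ W ⊓ W') :=
    logIndex_anti (le_inf (by rwa [inf_comm B W]) (inf_le_left.trans inf_le_left))
  have c9 := logIndex_inf_le (B ⊓ W) W'
  linarith

section DualNetwork

variable {N : ℕ} {F : Type u} [Field F]
  {Φ : Code.{u} (dualNetwork N) (dualRequirement N)}

/-- Ensures that the two sources used in a type 2 subnetwork are distinct, hence independent. -/
theorem NESet.ne_top_of_pair (t : Pair N) : t.set.top ≠ t.set := by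
  intro h
  have : t.elt ∈ t.set.1 := by rw [← h]; exact Finset.mem_univ _
  exact t.2 this

/-! ### Kernel inclusions imposed by the edges and receivers of the dual network. -/

section Kernels

variable [∀ f, AddCommGroup (Φ.alphabet f)] [∀ f, Module F (Φ.alphabet f)]
  (hΦ : ∀ e, IsLinearMap F (Φ.enc e))

/-- The sessions `NESet.full j` and `α.top` coincide by proof irrelevance, so this is the source
feeding `V j`. -/
theorem kernel_source_le_kernel_V (α : NESet N) (j : Fin N) :
    Φ.kernel hΦ (.inl α.top) ≤ Φ.kernel hΦ (.inr (.V j)) := by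
  intro x hx
  refine Code.mem_kernel_of_arrives hΦ ?_
  rintro (s | e) h
  · cases h
    exact hx
  · cases e <;> cases h

theorem kernel_V_le_of_tail_eq_dup {e : Edge N} {j : Fin N} (he : e.tail = .dup j) :
    Φ.kernel hΦ (.inr (.V j)) ≤ Φ.kernel hΦ (.inr e) := by
  intro x hx
  refine Code.mem_kernel_of_arrives hΦ fun f h => ?_
  change arrives (dualNetwork N) (dualRequirement N) e.tail f at h
  rw [he] at h
  rcases f with s | e
  · cases h
  · cases e <;> cases h
    exact hx

theorem kernel_source_le_of_tail_eq_source {e : Edge N} {α : NESet N} (he : e.tail = .source α) :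
    Φ.kernel hΦ (.inl α) ≤ Φ.kernel hΦ (.inr e) := by
  intro x hx
  refine Code.mem_kernel_of_arrives hΦ fun f h => ?_
  change arrives (dualNetwork N) (dualRequirement N) e.tail f at h
  rw [he] at h
  rcases f with s | e
  · cases h
    exact hx
  · cases e <;> cases h

theorem iInf_kernel_V_le_kernel_W1' (α : NESet N) :
    ⨅ j ∈ α.1, Φ.kernel hΦ (.inr (.V j)) ≤ Φ.kernel hΦ (.inr (.W1' α)) := by
  intro x hx
  simp only [Submodule.mem_iInf] at hx
  refine Code.mem_kernel_of_arrives hΦ ?_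
  rintro (s | e) h
  · cases h
  · cases e <;> cases h
    exact kernel_V_le_of_tail_eq_dup hΦ rfl (hx _ (Subtype.prop _))

theorem iInf_kernel_V_le_kernel_Wstarstar (t : Pair N) :
    ⨅ j ∈ t.set.1, Φ.kernel hΦ (.inr (.V j)) ≤ Φ.kernel hΦ (.inr (.Wstarstar t)) := by
  intro x hx
  simp only [Submodule.mem_iInf] at hx
  refine Code.mem_kernel_of_arrives hΦ ?_
  rintro (s | e) h
  · cases h
  · cases e <;> cases h
    exact kernel_V_le_of_tail_eq_dup hΦ rfl (hx _ (Subtype.prop _))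

theorem kernel_Wstarstar_le_of_tail_eq_fork {e : Edge N} {t : Pair N} (he : e.tail = .fork t) :
    Φ.kernel hΦ (.inr (.Wstarstar t)) ≤ Φ.kernel hΦ (.inr e) := by
  intro x hx
  refine Code.mem_kernel_of_arrives hΦ fun f h => ?_
  change arrives (dualNetwork N) (dualRequirement N) e.tail f at h
  rw [he] at h
  rcases f with s | e
  · cases h
  · cases e <;> cases h
    exact hx

theorem kernel_W2_le_of_tail_eq_split {e : Edge N} {t : Pair N} (he : e.tail = .split t) :
    Φ.kernel hΦ (.inr (.W2 t)) ≤ Φ.kernel hΦ (.inr e) := by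
  intro x hx
  refine Code.mem_kernel_of_arrives hΦ fun f h => ?_
  change arrives (dualNetwork N) (dualRequirement N) e.tail f at h
  rw [he] at h
  rcases f with s | e
  · cases h
  · cases e <;> cases h
    exact hx

theorem kernel_le_kernel_W2 (t : Pair N) :
    Φ.kernel hΦ (.inr (.Wstarstar t)) ⊓ Φ.kernel hΦ (.inl t.set) ≤ Φ.kernel hΦ (.inr (.W2 t)) := by
  rintro x ⟨h1, h2⟩
  refine Code.mem_kernel_of_arrives hΦ ?_
  rintro (s | e) h
  · cases h
  · cases e <;> cases h
    · exact kernel_source_le_of_tail_eq_source hΦ rfl h2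
    · exact kernel_Wstarstar_le_of_tail_eq_fork hΦ rfl h1

theorem kernel_le_kernel_W2'' (t : Pair N) :
    Φ.kernel hΦ (.inr (.Wstarstar t)) ⊓ Φ.kernel hΦ (.inr (.V t.elt)) ≤
      Φ.kernel hΦ (.inr (.W2'' t)) := by
  rintro x ⟨h1, h2⟩
  refine Code.mem_kernel_of_arrives hΦ ?_
  rintro (s | e) h
  · cases h
  · cases e <;> cases h
    · exact kernel_V_le_of_tail_eq_dup hΦ rfl h2
    · exact kernel_Wstarstar_le_of_tail_eq_fork hΦ rfl h1

theorem kernel_le_kernel_Wstar (t : Pair N) :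
    Φ.kernel hΦ (.inr (.W2'' t)) ⊓ Φ.kernel hΦ (.inr (.V t.elt)) ≤
      Φ.kernel hΦ (.inr (.Wstar t)) := by
  rintro x ⟨h1, h2⟩
  refine Code.mem_kernel_of_arrives hΦ ?_
  rintro (s | e) h
  · cases h
  · cases e <;> cases h
    · exact h1
    · exact kernel_V_le_of_tail_eq_dup hΦ rfl h2

variable (herr : Φ.errorProb < 1 / 2)
include herr

theorem kernel_sink1_le (α : NESet N) :
    Φ.kernel hΦ (.inr (.W1 α)) ⊓ Φ.kernel hΦ (.inr (.W1' α)) ≤ Φ.kernel hΦ (.inl α.top) := by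
  rintro x ⟨h1, h2⟩
  refine Code.eq_zero_of_errorProb_lt hΦ herr (v := .sink1 α) rfl ?_
  rintro (s | e) h
  · cases h
  · cases e <;> cases h
    · exact h1
    · exact h2

theorem kernel_upper_le (t : Pair N) :
    Φ.kernel hΦ (.inr (.W2 t)) ⊓ Φ.kernel hΦ (.inl t.set) ⊓ Φ.kernel hΦ (.inr (.W2' t)) ≤
      Φ.kernel hΦ (.inl t.set.top) := by
  rintro x ⟨⟨h1, h2⟩, h3⟩
  refine Code.eq_zero_of_errorProb_lt hΦ herr (v := .upper t) rfl ?_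
  rintro (s | e) h
  · cases h
  · cases e <;> cases h
    · exact h3
    · exact kernel_source_le_of_tail_eq_source hΦ rfl h2
    · exact kernel_W2_le_of_tail_eq_split hΦ rfl h1

theorem kernel_lower_le (t : Pair N) :
    Φ.kernel hΦ (.inr (.W2 t)) ⊓ Φ.kernel hΦ (.inr (.Wstar t)) ≤ Φ.kernel hΦ (.inl t.set) := by
  rintro x ⟨h1, h2⟩
  refine Code.eq_zero_of_errorProb_lt hΦ herr (v := .lower t) rfl ?_
  rintro (s | e) h
  · cases h
  · cases e <;> cases h
    · exact h2
    · exact kernel_W2_le_of_tail_eq_split hΦ rfl h1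

end Kernels

/-- The ranks of the messages `V_j` of a linear code, and the bounds on them that the subnetworks
enforce if the code can be decoded. -/
theorem exists_linearGroupChar_of_isLinear [Finite F] (hΦ : Φ.IsLinear F) :
    ∃ g ∈ linearGroupChar F N, g ∅ = 0 ∧ (∀ j, g {j} ≤ Φ.logCard (.inr (.V j))) ∧
      (Φ.errorProb < 1 / 2 →
        (∀ α : NESet N, Φ.logCard (.inl α.top) - Φ.logCard (.inr (.W1 α)) ≤ g α.1) ∧
        ∀ t : Pair N, g (insert t.elt t.set.1) ≤
          Φ.logCard (.inr (.V t.elt)) + Φ.logCard (.inr (.W2'' t)) + g t.set.1 +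
          Φ.logCard (.inr (.W2 t)) + Φ.logCard (.inr (.W2' t)) -
          Φ.logCard (.inl t.set) - Φ.logCard (.inl t.set.top)) := by
  obtain ⟨_, _, hΦ⟩ := hΦ
  refine ⟨_, logIndex_mem_linearGroupChar fun j => Φ.kernel hΦ (.inr (.V j)), ?_, fun j => ?_,
    fun herr => ⟨fun α => ?_, fun t => ?_⟩⟩
  · simp [logIndex_top]
  · simpa using Code.logIndex_kernel_le hΦ (.inr (.V j))
  -- Type 1: W and the `V_j`, j ∈ α, together determine the full source.
  · have h1 := logIndex_anti ((inf_le_inf_left _ (iInf_kernel_V_le_kernel_W1' hΦ α)).trans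
      (kernel_sink1_le hΦ herr α))
    have h2 := logIndex_inf_le (Φ.kernel hΦ (.inr (.W1 α)))
      (⨅ j ∈ α.1, Φ.kernel hΦ (.inr (.V j)))
    have h3 := Code.logIndex_kernel_le hΦ (.inr (.W1 α))
    rw [Code.logIndex_kernel_inl] at h1
    linarith
  -- Here `A`, `B` are the full source and the source α, `P` is the tuple of the `V_j` with j ∈ α,
  -- `Q` is `V_i`, `R` is W** and `T` is W*.
  · have h := logIndex_inf_le_of_subnetwork
      (Code.kernel_inl_sup hΦ (NESet.ne_top_of_pair t))
      (le_iInf₂ fun j (_ : j ∈ t.set.1) => kernel_source_le_kernel_V hΦ t.set j)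
      (kernel_source_le_kernel_V hΦ t.set t.elt)
      (iInf_kernel_V_le_kernel_Wstarstar hΦ t) (kernel_le_kernel_W2 hΦ t)
      (kernel_le_kernel_W2'' hΦ t) (kernel_le_kernel_Wstar hΦ t)
      (kernel_upper_le hΦ herr t) (kernel_lower_le hΦ herr t)
    rw [Code.logIndex_kernel_inl, Code.logIndex_kernel_inl, inf_comm] at h
    rw [Finset.iInf_insert]
    have h1 := Code.logIndex_kernel_le hΦ (.inr (.V t.elt))
    have h2 := Code.logIndex_kernel_le hΦ (.inr (.W2'' t))
    have h3 := Code.logIndex_kernel_le hΦ (.inr (.W2 t))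
    have h4 := Code.logIndex_kernel_le hΦ (.inr (.W2' t))
    linarith

/-! ### From achievable tuples to limits of linear group characterizable functions. -/

/-- The normalized alphabet sizes are bounded by sequences that converge to the capacities and
the rates. -/
theorem MeetsRates.exists_bounds {P E S : Type} [Finite S] [Finite E] {G : Network P E}
    {M : Requirement P S} {Φ : ℕ → Code.{u} G M} {r : ℕ → ℝ} {lam : S → ℝ} {ω : E → ℝ}
    (h : MeetsRates Φ r lam ω) :
    (∀ e, ∃ b : ℕ → ℝ, Tendsto b atTop (𝓝 (ω e)) ∧ ∀ n, (Φ n).logCard (.inr e) / r n ≤ b n) ∧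
    ∀ s, ∃ b : ℕ → ℝ, Tendsto b atTop (𝓝 (lam s)) ∧ ∀ n, b n ≤ (Φ n).logCard (.inl s) / r n := by
  constructor
  · intro e
    obtain ⟨_, b, _, hb, _, hle⟩ := h.1 e
    -- Adding the nonnegative slack `ω e - b` moves the limit exactly to the capacity.
    refine ⟨fun n => (Φ n).logCard (.inr e) / r n + (ω e - b), ?_, fun n => by linarith⟩
    simpa using hb.add_const (ω e - b)
  · intro s
    obtain ⟨a, _, ha, hle⟩ := h.2 s
    refine ⟨fun n => (Φ n).logCard (.inl s) / r n - (a - lam s), ?_, fun n => by linarith⟩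
    simpa using ha.sub_const (a - lam s)

theorem almostLinearGroupChar_of_achievable [Finite F] {h : Finset (Fin N) → ℝ} (h_empty : h ∅ = 0)
    (hach : Achievable (G := dualNetwork N) (M := dualRequirement N) (Code.IsLinear F)
      (rate h) (capacity h)) : AlmostLinearGroupChar F h := by
  obtain ⟨Φ, r, hlin, hr, hrates, herr⟩ := hach
  obtain ⟨hcap, hrate⟩ := hrates.exists_bounds
  choose u hu hule using hcap
  choose l hl hlle using hrate
  choose g hg g_empty hgV hgerr using fun n => exists_linearGroupChar_of_isLinear (hlin n)
  have hev : ∀ᶠ n in atTop, (Φ n).errorProb < 1 / 2 :=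
    herr.eventually (gt_mem_nhds (by norm_num))
  have hupper : ∀ α, ∃ v : ℕ → ℝ, Tendsto v atTop (𝓝 (h α)) ∧ ∀ᶠ n in atTop, g n α / r n ≤ v n := by
    intro α
    induction α using Finset.induction_on with
    | empty => exact ⟨fun _ => h ∅, tendsto_const_nhds, .of_forall fun n => by simp [g_empty, h_empty]⟩
    | insert i α hi ih =>
      rcases α.eq_empty_or_nonempty with rfl | hα
      -- Type 2 subnetworks exist only for nonempty sets, so singletons are bounded by the capacity
      -- of `V i` instead.
      · refine ⟨u (.V i), hu (.V i), .of_forall fun n => ?_⟩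
        exact (div_le_div_of_nonneg_right (by simpa using hgV n i) (hr n).le).trans (hule (.V i) n)
      · obtain ⟨v, hv, hle⟩ := ih
        let t : Pair N := ⟨(⟨α, hα⟩, i), hi⟩
        -- In the limit these terms telescope to `h (insert i α)`.
        refine ⟨fun n => u (.V i) n + u (.W2'' t) n + v n + u (.W2 t) n + u (.W2' t) n -
          l t.set n - l t.set.top n, ?_, ?_⟩
        · have := (((((hu (.V i)).add (hu (.W2'' t))).add hv).add (hu (.W2 t))).add
            (hu (.W2' t))).sub (hl t.set) |>.sub (hl t.set.top)
          convert this using 2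
          simp only [capacity, rate, t, Pair.elt, NESet.top]
          ring
        · filter_upwards [hle, hev] with n hn herrn
          have h1 := div_le_div_of_nonneg_right ((hgerr n herrn).2 t) (hr n).le
          simp only [add_div, sub_div] at h1
          have := hule (.V i) n
          have := hule (.W2'' t) n
          have := hule (.W2 t) n
          have := hule (.W2' t) n
          have := hlle t.set n
          have := hlle t.set.top n
          simp only [t, Pair.set, Pair.elt] at *
          linarith
  have hlower : ∀ α, ∃ v : ℕ → ℝ, Tendsto v atTop (𝓝 (h α)) ∧ ∀ᶠ n in atTop, v n ≤ g n α / r n := by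
    intro α
    rcases α.eq_empty_or_nonempty with rfl | hα
    · exact ⟨fun _ => h ∅, tendsto_const_nhds, .of_forall fun n => by simp [g_empty, h_empty]⟩
    · let β : NESet N := ⟨α, hα⟩
      -- The type 1 bound: the limit is h(N) − (h(N) − h(α)) = h(α).
      refine ⟨fun n => l β.top n - u (.W1 β) n, ?_, ?_⟩
      · have := (hl β.top).sub (hu (.W1 β))
        convert this using 2
        simp [capacity, rate, β, NESet.top]
      · filter_upwards [hev] with n herrn
        have h1 := div_le_div_of_nonneg_right ((hgerr n herrn).1 β) (hr n).le
        rw [sub_div] at h1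
        have := hule (.W1 β) n
        have := hlle β.top n
        exact le_trans (by linarith) h1
  refine ⟨g, r, hg, hr, fun α => ?_⟩
  obtain ⟨v, hv, hvle⟩ := hupper α
  obtain ⟨w, hw, hwle⟩ := hlower α
  exact tendsto_of_tendsto_of_tendsto_of_le_of_le' hw hv hwle hvle

end DualNetwork


/-! ### Linear codes with prescribed kernels -/

/-- The quotient by `ker f` embeds in `B`; a linear left inverse of this embedding extends the
factorization of `g` from the range of `f` to all of `B`. It supplies both encoders and decoders. -/
theorem exists_linearMap_of_ker_le {F A B C : Type*} [Field F] [AddCommGroup A] [Module F A]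
    [AddCommGroup B] [Module F B] [AddCommGroup C] [Module F C] (f : A →ₗ[F] B) (g : A →ₗ[F] C)
    (h : LinearMap.ker f ≤ LinearMap.ker g) : ∃ l : B →ₗ[F] C, ∀ x, l (f x) = g x := by
  obtain ⟨l, hl⟩ := LinearMap.exists_leftInverse_of_injective ((LinearMap.ker f).liftQ f le_rfl)
    (Submodule.ker_liftQ_eq_bot' _ _ rfl)
  refine ⟨(LinearMap.ker f).liftQ g h ∘ₗ l, fun x => ?_⟩
  have := LinearMap.congr_fun hl ((LinearMap.ker f).mkQ x)
  simp only [LinearMap.comp_apply, LinearMap.id_apply, Submodule.mkQ_apply,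
    Submodule.liftQ_apply] at this ⊢
  rw [this, Submodule.liftQ_apply]

section KernelCode

variable {P E S : Type} {F : Type u} [Field F] {A : S → Type u} [∀ s, AddCommGroup (A s)]
  [∀ s, Module F (A s)]

/-- The alphabets of a code that has prescribed source alphabets and link kernels. -/
def KernelAlphabet (K : E → Submodule F (∀ s, A s)) : S ⊕ E → Type u
  | .inl s => A s
  | .inr e => (∀ s, A s) ⧸ K e

variable (K : E → Submodule F (∀ s, A s))

noncomputable instance : ∀ f, AddCommGroup (KernelAlphabet K f)
  | .inl s => inferInstanceAs (AddCommGroup (A s))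
  | .inr e => inferInstanceAs (AddCommGroup ((∀ s, A s) ⧸ K e))

noncomputable instance : ∀ f, Module F (KernelAlphabet K f)
  | .inl s => inferInstanceAs (Module F (A s))
  | .inr e => inferInstanceAs (Module F ((∀ s, A s) ⧸ K e))

instance [Finite S] [∀ s, Finite (A s)] : ∀ f, Finite (KernelAlphabet K f)
  | .inl s => inferInstanceAs (Finite (A s))
  | .inr e => inferInstanceAs (Finite ((∀ s, A s) ⧸ K e))

/-- The symbols of a code that has prescribed source alphabets and link kernels. -/
def kernelSymbol : ∀ f, (∀ s, A s) →ₗ[F] KernelAlphabet K f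
  | .inl s => LinearMap.proj (R := F) (φ := A) s
  | .inr e => (K e).mkQ

theorem kernelSymbol_surjective : ∀ f, Function.Surjective (kernelSymbol K f)
  | .inl s => LinearMap.proj_surjective (R := F) (φ := A) s
  | .inr e => (K e).mkQ_surjective

variable {K} [Finite S] [Finite E] [∀ s, Finite (A s)]

/-- Kernels that respect the network are the kernels of the symbols of a linear code. The code has
no errors if the kernels at each receiver determine the requested sources. -/
theorem exists_code_of_kernels (G : Network P E) (M : Requirement P S)
    (henc : ∀ e x, (∀ f, arrives G M (G.tail e) f → kernelSymbol K f x = 0) → x ∈ K e)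
    (hdec : ∀ s, ∀ v ∈ M.dest s, ∀ x, (∀ f, arrives G M v f → kernelSymbol K f x = 0) → x s = 0) :
    ∃ Φ : Code.{u} G M, Φ.IsLinear F ∧ Φ.errorProb = 0 ∧
      ∀ f, entropy (Φ.law f) = logIndex (LinearMap.ker (kernelSymbol K f)) ∧
        Φ.logCard f = logIndex (LinearMap.ker (kernelSymbol K f)) := by
  choose enc henc' using fun e => exists_linearMap_of_ker_le
    (LinearMap.pi fun f : Incoming G M (G.tail e) => kernelSymbol K f.1) (kernelSymbol K (.inr e))
    (fun x hx => by
      have := henc e x fun f hf => congrFun (LinearMap.mem_ker.1 hx) ⟨f, hf⟩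
      exact (Submodule.Quotient.mk_eq_zero _).2 this)
  choose dec hdec' using fun (s : S) (v : M.dest s) => exists_linearMap_of_ker_le
    (LinearMap.pi fun f : Incoming G M v.1 => kernelSymbol K f.1)
    (LinearMap.proj (R := F) (φ := A) s)
    (fun x hx => hdec s v.1 v.2 x fun f hf => congrFun (LinearMap.mem_ker.1 hx) ⟨f, hf⟩)
  let Φ : Code.{u} G M :=
    { alphabet := KernelAlphabet K
      finite := inferInstance
      nonempty := fun _ => ⟨0⟩
      enc := fun e => enc e }
  have hsymbol : ∀ (x : Φ.Input) f, Φ.symbol x f = kernelSymbol K f x := by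
    intro x f
    rcases f with s | e
    · rfl
    induction e using G.wellFounded.induction with
    | _ e ih =>
      rw [Code.symbol_inr, ← henc' e x]
      refine congrArg (enc e) (funext ?_)
      rintro ⟨s | f, hf⟩
      · rfl
      · exact ih f hf
  refine ⟨Φ, ⟨inferInstanceAs (∀ f, AddCommGroup (KernelAlphabet K f)),
    inferInstanceAs (∀ f, Module F (KernelAlphabet K f)), fun e => (enc e).isLinear⟩, ?_,
    fun f => ⟨?_, ?_⟩⟩
  · let δ : Φ.Decoder := fun s v => dec s v
    have hδ : Φ.errorProbWith δ = 0 := by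
      rw [Code.errorProbWith_eq]
      have : {x : Φ.Input | ∃ (s : S) (v : M.dest s),
          δ s v (fun f => Φ.symbol x f.1) ≠ x s} = ∅ := by
        rw [Set.eq_empty_iff_forall_notMem]
        rintro x ⟨s, v, hne⟩
        refine hne ?_
        simp only [hsymbol]
        exact hdec' s v x
      rw [this]
      simp
    have : Nonempty Φ.Decoder := ⟨δ⟩
    refine le_antisymm (hδ ▸ ciInf_le ⟨0, ?_⟩ δ) (le_ciInf fun δ => Φ.errorProbWith_nonneg δ)
    rintro _ ⟨δ, rfl⟩
    exact Φ.errorProbWith_nonneg δ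
  · rw [← entropy_uniformLaw_map]
    exact congrArg (fun s => entropy ((uniformLaw (∀ s, A s)).map s)) (funext fun x => hsymbol x f)
  · exact (logIndex_ker_of_surjective (kernelSymbol_surjective K f)).symm

end KernelCode

/-! ### Codes for the dual network from subspaces -/

/-- A subspace that contains `A` and is a complement of `B` relative to `A`. -/
noncomputable def relCompl {F G : Type*} [Field F] [AddCommGroup G] [Module F G]
    (A B : Submodule F G) : Submodule F G :=
  A ⊔ (exists_isCompl B).choose

section RelCompl

variable {F G : Type u} [Field F] [AddCommGroup G] [Module F G] {A B : Submodule F G}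

theorem le_relCompl : A ≤ relCompl A B := le_sup_left

/-- By the modular law. Thus `relCompl A B` is a message that restores `A` from the side information
`B`, at the cost of only the conditional entropy. -/
theorem relCompl_inf (h : A ≤ B) : relCompl A B ⊓ B = A := by
  rw [relCompl, sup_inf_assoc_of_le _ h, inf_comm, (exists_isCompl B).choose_spec.inf_eq_bot,
    sup_bot_eq]

theorem relCompl_sup : relCompl A B ⊔ B = ⊤ := by
  rw [relCompl, sup_assoc, sup_comm _ B, (exists_isCompl B).choose_spec.sup_eq_top, sup_top_eq]

theorem logIndex_relCompl [Finite F] [Finite G] (h : A ≤ B) :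
    logIndex (relCompl A B) = logIndex A - logIndex B := by
  have := logIndex_inf_of_sup_eq_top (relCompl_sup (A := A) (B := B))
  rw [relCompl_inf h] at this
  linarith

end RelCompl

section DualCode

variable {F : Type u} [Field F] {N : ℕ} {G : Type u} [AddCommGroup G] [Module F G]
  (W : Fin N → Submodule F G)

/-- The intersection of the subspaces with index in `α`. -/
def meet (α : Finset (Fin N)) : Submodule F G := ⨅ i ∈ α, W i

variable {W}

theorem mem_meet {α : Finset (Fin N)} {x : G} : x ∈ meet W α ↔ ∀ i ∈ α, x ∈ W i := by
  simp [meet]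

theorem meet_anti {α β : Finset (Fin N)} (h : α ⊆ β) : meet W β ≤ meet W α :=
  fun _ hx => mem_meet.2 fun i hi => mem_meet.1 hx i (h hi)

theorem meet_le {α : Finset (Fin N)} {i : Fin N} (h : i ∈ α) : meet W α ≤ W i :=
  fun _ hx => mem_meet.1 hx i h

theorem meet_singleton (i : Fin N) : meet W {i} = W i := by
  simp [meet]

theorem meet_top_le (α : NESet N) (β : Finset (Fin N)) : meet W α.top.1 ≤ meet W β :=
  meet_anti (Finset.subset_univ β)

variable (W)

/-- The tuples of source symbols whose component in the session `α` lies in the image of `C`. -/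
def sourceIn (α : NESet N) (C : Submodule F G) :
    Submodule F (∀ β : NESet N, G ⧸ meet W β.1) :=
  (C.map (meet W α.1).mkQ).comap (LinearMap.proj α)

/-- The sum of the source symbol of `α` and the image of the symbol of the full session. -/
def maskedSource (α : NESet N) : (∀ β : NESet N, G ⧸ meet W β.1) →ₗ[F] G ⧸ meet W α.1 :=
  LinearMap.proj α +
    Submodule.factor (meet_top_le α α.1) ∘ₗ
      LinearMap.proj (φ := fun β : NESet N => G ⧸ meet W β.1) α.top

/-- The kernels of the link symbols of the code for the dual network. -/
noncomputable def dualKernel :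
    Edge N → Submodule F (∀ β : NESet N, G ⧸ meet W β.1)
  | .V j => sourceIn W (.full j) (W j)
  | .W0 α => LinearMap.ker (LinearMap.proj α)
  | .W1 α => sourceIn W α.top (relCompl (meet W Finset.univ) (meet W α.1))
  | .W1' α => sourceIn W α.top (meet W α.1)
  | .fwdV1 α j => sourceIn W α.top (W j)
  | .W2 t => LinearMap.ker (maskedSource W t.set)
  | .W2' t => sourceIn W t.set.top (relCompl (meet W Finset.univ) (meet W t.set.1))
  | .W2'' t => sourceIn W t.set.top (relCompl (meet W (insert t.elt t.set.1)) (W t.elt))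
  | .Wstar t => sourceIn W t.set.top (meet W t.set.1)
  | .Wstarstar t => sourceIn W t.set.top (meet W t.set.1)
  | .fwdV2 t j => sourceIn W t.set.top (W j)
  | .fwdViCompress t => sourceIn W t.set.top (W t.elt)
  | .fwdViExpand t => sourceIn W t.set.top (W t.elt)
  | .fwdSCombine t => LinearMap.ker (LinearMap.proj t.set)
  | .fwdSUpper t => LinearMap.ker (LinearMap.proj t.set)
  | .fwdForkCombine t => sourceIn W t.set.top (meet W t.set.1)
  | .fwdForkCompress t => sourceIn W t.set.top (meet W t.set.1)
  | .fwdWUpper t => LinearMap.ker (maskedSource W t.set)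
  | .fwdWLower t => LinearMap.ker (maskedSource W t.set)

/-- The link entropies of the code for the dual network. -/
def linkRate (g : Finset (Fin N) → ℝ) : Edge N → ℝ
  | .V j => g {j}
  | .W0 α => g α.1
  | .W1 α => g Finset.univ - g α.1
  | .W1' α => g α.1
  | .fwdV1 _ j => g {j.1}
  | .W2 t => g t.set.1
  | .W2' t => g Finset.univ - g t.set.1
  | .W2'' t => g (insert t.elt t.set.1) - g {t.elt}
  | .Wstar t => g t.set.1
  | .Wstarstar t => g t.set.1
  | .fwdV2 _ j => g {j.1}
  | .fwdViCompress t => g {t.elt}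
  | .fwdViExpand t => g {t.elt}
  | .fwdSCombine t => g t.set.1
  | .fwdSUpper t => g t.set.1
  | .fwdForkCombine t => g t.set.1
  | .fwdForkCompress t => g t.set.1
  | .fwdWUpper t => g t.set.1
  | .fwdWLower t => g t.set.1

variable {W}

/-- The choice of representative is immaterial because `C` contains the subspace divided out. -/
theorem mem_sourceIn {α : NESet N} {C : Submodule F G} (hC : meet W α.1 ≤ C)
    {x : ∀ β : NESet N, G ⧸ meet W β.1} {y : G} (hy : (meet W α.1).mkQ y = x α) :
    x ∈ sourceIn W α C ↔ y ∈ C := by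
  rw [sourceIn, Submodule.mem_comap, LinearMap.proj_apply, ← hy, ← Submodule.mem_comap,
    Submodule.comap_map_mkQ, sup_eq_right.2 hC]

theorem sourceIn_eq_ker {α : NESet N} {C : Submodule F G} (hC : meet W α.1 ≤ C) :
    sourceIn W α C = LinearMap.ker (Submodule.factor hC ∘ₗ
      LinearMap.proj (R := F) (φ := fun β : NESet N => G ⧸ meet W β.1) α) := by
  ext x
  obtain ⟨y, hy⟩ := (meet W α.1).mkQ_surjective (x α)
  rw [mem_sourceIn hC hy, LinearMap.mem_ker, LinearMap.comp_apply, LinearMap.proj_apply, ← hy]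
  simp

/-- When the masked sum vanishes, its two summands are negatives of each other. The upper receiver
uses one direction and the lower receiver the other. -/
theorem mem_ker_maskedSource {α : NESet N}
    {x : ∀ β : NESet N, G ⧸ meet W β.1} {y : G} (hy : (meet W α.top.1).mkQ y = x α.top)
    (hx : x ∈ LinearMap.ker (maskedSource W α)) : x α = 0 ↔ y ∈ meet W α.1 := by
  rw [LinearMap.mem_ker, maskedSource, LinearMap.add_apply, LinearMap.comp_apply,
    LinearMap.proj_apply, LinearMap.proj_apply, ← hy] at hx
  rw [← Submodule.Quotient.mk_eq_zero (meet W α.1)]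
  have h : x α + Submodule.Quotient.mk (p := meet W α.1) y = 0 := hx
  rw [add_eq_zero_iff_eq_neg] at h
  rw [h, neg_eq_zero]

theorem logIndex_sourceIn {α : NESet N} {C : Submodule F G} (hC : meet W α.1 ≤ C) :
    logIndex (sourceIn W α C) = logIndex C := by
  rw [sourceIn_eq_ker hC, logIndex_ker_of_surjective, logIndex]
  exact (Submodule.factor_surjective hC).comp (LinearMap.proj_surjective α)

theorem logIndex_ker_proj (α : NESet N) :
    logIndex (LinearMap.ker (LinearMap.proj (R := F) (φ := fun β : NESet N => G ⧸ meet W β.1) α)) =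
      logIndex (meet W α.1) := by
  rw [logIndex_ker_of_surjective (LinearMap.proj_surjective α), logIndex]

/-- Varying only the component `α`, which differs from `α.top`, already reaches every value of the
sum. -/
theorem logIndex_ker_maskedSource {α : NESet N} (hα : α.top ≠ α) :
    logIndex (LinearMap.ker (maskedSource W α)) = logIndex (meet W α.1) := by
  classical
  rw [logIndex_ker_of_surjective, logIndex]
  intro a
  refine ⟨Pi.single α a, ?_⟩
  simp [maskedSource, Pi.single_eq_of_ne hα]

theorem logIndex_dualKernel [Finite F] [Finite G] (e : Edge N) :
    logIndex (dualKernel W e) = linkRate (fun α => logIndex (meet W α)) e := by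
  have hV : ∀ (α : NESet N) j, logIndex (sourceIn W α.top (W j)) = logIndex (meet W {j}) :=
    fun α j => by rw [logIndex_sourceIn (meet_le (Finset.mem_univ j)), meet_singleton]
  have hU : ∀ α : NESet N, logIndex (sourceIn W α.top (meet W α.1)) = logIndex (meet W α.1) :=
    fun α => logIndex_sourceIn (meet_anti (Finset.subset_univ _))
  have hC : ∀ α : NESet N, logIndex (sourceIn W α.top
      (relCompl (meet W Finset.univ) (meet W α.1))) =
      logIndex (meet W Finset.univ) - logIndex (meet W α.1) :=
    fun α => by
      rw [logIndex_sourceIn (α := α.top) (C := relCompl (meet W Finset.univ) (meet W α.1))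
        le_relCompl, logIndex_relCompl (meet_anti (Finset.subset_univ _))]
  have hS : ∀ t : Pair N, logIndex (LinearMap.ker (maskedSource W t.set)) =
      logIndex (meet W t.set.1) :=
    fun t => logIndex_ker_maskedSource (NESet.ne_top_of_pair t)
  have hC' : ∀ t : Pair N, logIndex (sourceIn W t.set.top
      (relCompl (meet W (insert t.elt t.set.1)) (W t.elt))) =
      logIndex (meet W (insert t.elt t.set.1)) - logIndex (meet W {t.elt}) := fun t => by
    rw [logIndex_sourceIn ((meet_top_le _ _).trans le_relCompl),
      logIndex_relCompl (meet_le (Finset.mem_insert_self _ _)), meet_singleton]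
  cases e <;> rw [dualKernel, linkRate]
  case V j => exact hV (.full j) j
  case W0 | fwdSCombine | fwdSUpper => exact logIndex_ker_proj _
  case W1 | W2' => exact hC _
  case W1' | Wstar | Wstarstar | fwdForkCombine | fwdForkCompress => exact hU _
  case W2 | fwdWUpper | fwdWLower => exact hS _
  case W2'' => exact hC' _
  case fwdV1 | fwdV2 | fwdViCompress | fwdViExpand => exact hV _ _

end DualCode


/-! ### Encodability and decodability of the code built from subspaces. -/

section DualCode

variable {F : Type u} [Field F] {N : ℕ} {G : Type u} [AddCommGroup G] [Module F G]
  {W : Fin N → Submodule F G}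

theorem mem_sourceIn_of_eq_zero {α : NESet N} {C : Submodule F G}
    {x : ∀ β : NESet N, G ⧸ meet W β.1} (hx : x α = 0) : x ∈ sourceIn W α C := by
  rw [sourceIn, Submodule.mem_comap, LinearMap.proj_apply, hx]
  exact zero_mem _

theorem mem_sourceIn_top {α : NESet N} {C : Submodule F G} {β : Finset (Fin N)}
    (hC : meet W β ≤ C) {x : ∀ β : NESet N, G ⧸ meet W β.1} {y : G}
    (hy : (meet W α.top.1).mkQ y = x α.top) : x ∈ sourceIn W α.top C ↔ y ∈ C :=
  mem_sourceIn ((meet_top_le α β).trans hC) hy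

theorem mem_sourceIn_top_meet {α : NESet N} {x : ∀ β : NESet N, G ⧸ meet W β.1}
    (hx : ∀ i ∈ α.1, x ∈ sourceIn W α.top (W i)) : x ∈ sourceIn W α.top (meet W α.1) := by
  obtain ⟨y, hy⟩ := (meet W α.top.1).mkQ_surjective (x α.top)
  rw [mem_sourceIn_top le_rfl hy, mem_meet]
  exact fun i hi => (mem_sourceIn_top (meet_singleton i).le hy).1 (hx i hi)

theorem mem_ker_maskedSource_of_mem {α : NESet N} {x : ∀ β : NESet N, G ⧸ meet W β.1}
    (hx : x ∈ sourceIn W α.top (meet W α.1)) (hα : x α = 0) :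
    x ∈ LinearMap.ker (maskedSource W α) := by
  obtain ⟨y, hy⟩ := (meet W α.top.1).mkQ_surjective (x α.top)
  rw [mem_sourceIn_top le_rfl hy] at hx
  rw [LinearMap.mem_ker, maskedSource, LinearMap.add_apply, LinearMap.comp_apply,
    LinearMap.proj_apply, LinearMap.proj_apply, ← hy, hα, zero_add]
  exact (Submodule.Quotient.mk_eq_zero _).2 hx

theorem mem_dualKernel_of_arrives {x : ∀ β : NESet N, G ⧸ meet W β.1} (e : Edge N)
    (hsrc : ∀ α, Node.source α = e.tail → x α = 0)
    (hlink : ∀ f : Edge N, f.head = e.tail → x ∈ dualKernel W f) : x ∈ dualKernel W e := by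
  have hsingle : ∀ i, meet W {i} ≤ W i := fun i => (meet_singleton i).le
  cases e with
  | V j => exact mem_sourceIn_of_eq_zero (hsrc _ rfl)
  | W0 α => exact hsrc α rfl
  | W1 α => exact mem_sourceIn_of_eq_zero (hsrc _ rfl)
  | W1' α => exact mem_sourceIn_top_meet fun i hi => hlink (.fwdV1 α ⟨i, hi⟩) rfl
  | fwdV1 α j => exact hlink (.V j.1) rfl
  | W2 t =>
    exact mem_ker_maskedSource_of_mem (hlink (.fwdForkCombine t) rfl) (hlink (.fwdSCombine t) rfl)
  | W2' t => exact mem_sourceIn_of_eq_zero (hsrc _ rfl)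
  | W2'' t =>
    have h1 : x ∈ sourceIn W t.set.top (meet W t.set.1) := hlink (.fwdForkCompress t) rfl
    have h2 : x ∈ sourceIn W t.set.top (W t.elt) := hlink (.fwdViCompress t) rfl
    obtain ⟨y, hy⟩ := (meet W t.set.top.1).mkQ_surjective (x t.set.top)
    rw [mem_sourceIn_top le_rfl hy, mem_meet] at h1
    rw [mem_sourceIn_top (hsingle _) hy] at h2
    exact (mem_sourceIn_top le_relCompl hy).2 (le_relCompl (mem_meet.2
      (Finset.forall_mem_insert _ _ _ |>.2 ⟨h2, h1⟩)))
  | Wstar t =>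
    have h1 : x ∈ sourceIn W t.set.top (relCompl (meet W (insert t.elt t.set.1)) (W t.elt)) :=
      hlink (.W2'' t) rfl
    have h2 : x ∈ sourceIn W t.set.top (W t.elt) := hlink (.fwdViExpand t) rfl
    obtain ⟨y, hy⟩ := (meet W t.set.top.1).mkQ_surjective (x t.set.top)
    rw [mem_sourceIn_top le_relCompl hy] at h1
    rw [mem_sourceIn_top (hsingle _) hy] at h2
    -- W'' and `V_i` together restore the coset of `α ∪ {i}`, which determines that of `α`.
    have h3 := (relCompl_inf (meet_le (W := W) (Finset.mem_insert_self t.elt t.set.1))).le ⟨h1, h2⟩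
    exact (mem_sourceIn_top le_rfl hy).2 (meet_anti (Finset.subset_insert _ _) h3)
  | Wstarstar t => exact mem_sourceIn_top_meet fun i hi => hlink (.fwdV2 t ⟨i, hi⟩) rfl
  | fwdV2 t j => exact hlink (.V j.1) rfl
  | fwdViCompress t => exact hlink (.V t.elt) rfl
  | fwdViExpand t => exact hlink (.V t.elt) rfl
  | fwdSCombine t => exact hsrc _ rfl
  | fwdSUpper t => exact hsrc _ rfl
  | fwdForkCombine t => exact hlink (.Wstarstar t) rfl
  | fwdForkCompress t => exact hlink (.Wstarstar t) rfl
  | fwdWUpper t => exact hlink (.W2 t) rfl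
  | fwdWLower t => exact hlink (.W2 t) rfl

/-- Decoding shared by the type 1 receiver and the upper type 2 receiver: the relative complement
restores what the coset for `α` lacks. -/
theorem source_top_eq_zero {α : NESet N} {x : ∀ β : NESet N, G ⧸ meet W β.1}
    (h1 : x ∈ sourceIn W α.top (relCompl (meet W Finset.univ) (meet W α.1)))
    (h2 : x ∈ sourceIn W α.top (meet W α.1)) : x α.top = 0 := by
  obtain ⟨y, hy⟩ := (meet W α.top.1).mkQ_surjective (x α.top)
  rw [mem_sourceIn_top le_relCompl hy] at h1
  rw [mem_sourceIn_top le_rfl hy] at h2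
  rw [← hy]
  exact (Submodule.Quotient.mk_eq_zero _).2 ((relCompl_inf (meet_top_le α α.1)).le ⟨h1, h2⟩)

theorem eq_zero_of_demand {x : ∀ β : NESet N, G ⧸ meet W β.1} {v : Node N} {α : NESet N}
    (hv : v.demand = some α) (hlink : ∀ f : Edge N, f.head = v → x ∈ dualKernel W f) :
    x α = 0 := by
  cases v <;> cases hv
  case sink0 => exact hlink (.W0 α) rfl
  case sink1 β => exact source_top_eq_zero (hlink (.W1 β) rfl) (hlink (.W1' β) rfl)
  case upper t =>
    -- Knowing the source α, the upper receiver unmasks W to obtain the coset for α.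
    refine source_top_eq_zero (hlink (.W2' t) rfl) ?_
    obtain ⟨y, hy⟩ := (meet W t.set.top.1).mkQ_surjective (x t.set.top)
    exact (mem_sourceIn_top le_rfl hy).2
      ((mem_ker_maskedSource hy (hlink (.fwdWUpper t) rfl)).1 (hlink (.fwdSUpper t) rfl))
  case lower t =>
    -- Knowing the coset for α from W*, the lower receiver unmasks W to obtain the source α.
    have h : x ∈ sourceIn W t.set.top (meet W t.set.1) := hlink (.Wstar t) rfl
    obtain ⟨y, hy⟩ := (meet W t.set.top.1).mkQ_surjective (x t.set.top)
    exact (mem_ker_maskedSource hy (hlink (.fwdWLower t) rfl)).2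
      ((mem_sourceIn_top le_rfl hy).1 h)

/-- A linear group characterizable function yields a linear code without errors. -/
theorem exists_code_of_linearGroupChar [Finite F] {g : Finset (Fin N) → ℝ}
    (hg : g ∈ linearGroupChar F N) :
    ∃ Φ : Code.{u} (dualNetwork N) (dualRequirement N), Φ.IsLinear F ∧ Φ.errorProb = 0 ∧
      (∀ α, entropy (Φ.law (.inl α)) = rate g α ∧ Φ.logCard (.inl α) = rate g α) ∧
      ∀ e, entropy (Φ.law (.inr e)) = linkRate g e ∧ Φ.logCard (.inr e) = linkRate g e := by
  obtain ⟨G, _, _, _, W, hW⟩ := mem_linearGroupChar_iff.1 hg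
  obtain rfl : g = fun α => logIndex (meet W α) := funext hW
  have hlink : ∀ {x : ∀ β : NESet N, G ⧸ meet W β.1} {v : Node N},
      (∀ f, arrives (dualNetwork N) (dualRequirement N) v f →
        kernelSymbol (dualKernel W) f x = 0) → ∀ f : Edge N, f.head = v → x ∈ dualKernel W f :=
    fun hx f hf => (Submodule.Quotient.mk_eq_zero _).1 (hx (.inr f) hf)
  obtain ⟨Φ, hlin, herr, hent⟩ := exists_code_of_kernels (K := dualKernel W)
    (dualNetwork N) (dualRequirement N)
    (fun e x hx => mem_dualKernel_of_arrives e (fun α hα => hx (.inl α) hα) (hlink hx))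
    (fun α v hv x hx => eq_zero_of_demand hv (hlink hx))
  refine ⟨Φ, hlin, herr, fun α => ?_, fun e => ?_⟩
  · have h : logIndex (LinearMap.ker (kernelSymbol (dualKernel W) (.inl α))) =
        rate (fun α => logIndex (meet W α)) α := logIndex_ker_proj α
    exact ⟨(hent _).1.trans h, (hent _).2.trans h⟩
  · have h : logIndex (LinearMap.ker (kernelSymbol (dualKernel W) (.inr e))) =
        linkRate (fun α => logIndex (meet W α)) e := by
      rw [← logIndex_dualKernel]
      exact congrArg logIndex (dualKernel W e).ker_mkQ
    exact ⟨(hent _).1.trans h, (hent _).2.trans h⟩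

end DualCode

/-! ### Asymptotic admissibility from limits of linear group characterizable functions. -/

section Admissible

variable {N : ℕ}

/-- Only the uncapacitated edges need an argument: a sum of nonnegative values dominates each of
them. -/
theorem linkRate_le_capacity {h : Finset (Fin N) → ℝ} (h0 : ∀ α, 0 ≤ h α) (e : Edge N) :
    linkRate h e ≤ capacity h e := by
  have hle : ∀ α, h α ≤ ∑ β, h β := fun α =>
    Finset.single_le_sum (f := h) (fun β _ => h0 β) (Finset.mem_univ α)
  cases e <;> first | exact le_rfl | exact hle _

theorem tendsto_linkRate {g : ℕ → Finset (Fin N) → ℝ} {r : ℕ → ℝ} {h : Finset (Fin N) → ℝ}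
    (hlim : ∀ α, Tendsto (fun n => g n α / r n) atTop (𝓝 (h α))) (e : Edge N) :
    Tendsto (fun n => linkRate (g n) e / r n) atTop (𝓝 (linkRate h e)) := by
  cases e <;> simp only [linkRate, sub_div] <;>
    first | exact hlim _ | exact (hlim _).sub (hlim _)

theorem asymptoticallyAdmissible_of_almostLinearGroupChar {F : Type u} [Field F] [Finite F]
    {h : Finset (Fin N) → ℝ} (hh : AlmostLinearGroupChar F h) :
    AsymptoticallyAdmissible (G := dualNetwork N) (M := dualRequirement N) (Code.IsLinear F)
      (rate h) (capacity h) := by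
  obtain ⟨g, r, hg, hr, hlim⟩ := hh
  -- Nonnegativity is inherited from entropies through the limit.
  have h0 : ∀ α, 0 ≤ h α := fun α => ge_of_tendsto' (hlim α) fun n => by
    obtain ⟨G, _, _, _, W, hW⟩ := mem_linearGroupChar_iff.1 (hg n)
    rw [hW]
    exact div_nonneg (logIndex_nonneg _) (hr n).le
  choose Φ hlin herr hsrc hlink using fun n => exists_code_of_linearGroupChar (hg n)
  refine ⟨Φ, r, hlin, hr, ⟨fun e => ⟨linkRate h e, linkRate h e, ?_, ?_, le_rfl,
    linkRate_le_capacity h0 e⟩, fun α => ⟨rate h α, ?_, ?_, le_rfl⟩⟩, herr⟩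
  · simpa only [(hlink _ e).1] using tendsto_linkRate hlim e
  · simpa only [(hlink _ e).2] using tendsto_linkRate hlim e
  · simpa only [(hsrc _ α).1, rate] using hlim α.1
  · simpa only [(hsrc _ α).2, rate] using hlim α.1

end Admissible

end NetCode

theorem theorem4 {F : Type*} [Field F] [Finite F] (N : ℕ)
    (h : Finset (Fin N) → ℝ) (h_empty : h ∅ = 0) :
    List.TFAE [
      h ∈ NetCode.closedConvexCone (NetCode.linearGroupChar F N),
      NetCode.AlmostLinearGroupChar F h,
      NetCode.AsymptoticallyAdmissible (G := NetCode.dualNetwork N)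
        (M := NetCode.dualRequirement N) (NetCode.Code.IsLinear F)
        (NetCode.rate h) (NetCode.capacity h),
      NetCode.Achievable (G := NetCode.dualNetwork N)
        (M := NetCode.dualRequirement N) (NetCode.Code.IsLinear F)
        (NetCode.rate h) (NetCode.capacity h)] := by
  tfae_have 1 ↔ 2 := NetCode.mem_closedConvexCone_iff
  tfae_have 2 → 3 := NetCode.asymptoticallyAdmissible_of_almostLinearGroupChar
  tfae_have 3 → 4
  | ⟨Φ, r, hlin, hr, hrates, herr⟩ => ⟨Φ, r, hlin, hr, hrates, by simp [herr]⟩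
  tfae_have 4 → 2 := NetCode.almostLinearGroupChar_of_achievable h_empty
  tfae_finish
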